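/- Let $(M^4,g,J)$ be a Kähler surface: a smooth $4$-manifold with an integrable almost complex structure $J$ and a Riemannian metric $g$ with $g(J\cdot,J\cdot)=g$ whose Kähler form $\omega=g(J\cdot,\cdot)$ is closed. Let $r$ be the Ricci tensor, $s$ the scalar curvature, $\rho=r(J\cdot,\cdot)$ the Ricci form and $W$ the Weyl curvature of $g$, with the sign conventions for which $r_{bd}=R^{a}{}_{bad}$ and the round sphere has $s>0$. Let $$B_{ab}=\Big(\nabla^c\nabla^d+\tfrac12 r^{cd}\Big)W_{acbd}$$ be the Bach tensor. Orient $M$ by $\omega\wedge\omega>0$. For a $(1,1)$-form $\alpha$ let $[\alpha]_0=\alpha-\tfrac12(\Lambda\alpha)\,\omega$, with $\Lambda\alpha=\tfrac12\omega^{ab}\alpha_{ab}$, be its primitive part. Suppose that $g$ is extremal, i.e. that $\operatorname{grad}^{1,0}s$ is a holomorphic vector field (equivalently, $\mathcal L_{\operatorname{grad}s}J=0$). Then $\psi:=B(J\cdot,\cdot)$ is a smooth real $2$-form of type $(1,1)$ that is harmonic ($d\psi=0$ and $\delta\psi=0$) and anti-self-dual ($\star\psi=-\psi$), the Bach tensor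 is $B=\psi(\cdot,J\cdot)$, and $$\psi=\tfrac16\big[\,s\rho+2i\partial\bar\partial s\,\big]_0 .$$ -/

import Mathlib

open scoped Manifold ContDiff

noncomputable section

/-- The model space of a real 4-manifold. -/
abbrev E4 : Type := EuclideanSpace ℝ (Fin 4)

/-! ## Tensor calculus in coordinates

A tensor field on (an open subset of) `E4` is given by its components. A metric `g` is a field of
matrices `g y i j`, an endomorphism field `J` is a field of matrices `J y a b` with `a` the upper
and `b` the lower index, so that `J ∂_b = ∑ a, J y a b • ∂_a`. -/

namespace Coord

/-- Fields of real `4 × 4` matrices. -/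
abbrev MatField : Type := E4 → Matrix (Fin 4) (Fin 4) ℝ

/-- Components of covariant tensor fields of rank `k`. -/
abbrev CovTensor (k : ℕ) : Type := E4 → (Fin k → Fin 4) → ℝ

/-- Components of a tensor field with two lower indices (in particular of a 2-form). -/
abbrev Bilin : Type := E4 → Fin 4 → Fin 4 → ℝ

/-- The partial derivative `∂_i f`. -/
def pd {F : Type} [NormedAddCommGroup F] [NormedSpace ℝ F] (i : Fin 4) (f : E4 → F) (y : E4) : F :=
  fderiv ℝ f y (EuclideanSpace.single i 1)

/-- The inverse metric `g^{ij}`. -/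
def ginv (g : MatField) : MatField := fun y => (g y)⁻¹

/-- Christoffel symbols `Γ^k_{ij}` of the Levi-Civita connection. -/
def christoffel (g : MatField) (y : E4) (k i j : Fin 4) : ℝ :=
  (1 / 2) * ∑ l, ginv g y k l *
    (pd i (fun z => g z j l) y + pd j (fun z => g z i l) y - pd l (fun z => g z i j) y)

/-- `R(∂_i, ∂_j) ∂_k = ∑ l, curvUp g y l k i j • ∂_l`, where
`R(X, Y) = ∇_X ∇_Y - ∇_Y ∇_X - ∇_[X,Y]`. -/
def curvUp (g : MatField) (y : E4) (l k i j : Fin 4) : ℝ :=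
  pd i (fun z => christoffel g z l j k) y - pd j (fun z => christoffel g z l i k) y
    + ∑ m, (christoffel g y l i m * christoffel g y m j k
      - christoffel g y l j m * christoffel g y m i k)

/-- `R_{ijkl} = g(R(∂_i, ∂_j) ∂_l, ∂_k)`; thus `R_{ijij} > 0` for `i ≠ j` on a round sphere in
orthogonal coordinates. -/
def riem (g : MatField) (y : E4) (i j k l : Fin 4) : ℝ := ∑ m, g y k m * curvUp g y m l i j

/-- The Ricci tensor `r_{jl} = g^{ik} R_{ijkl}`. -/
def ricci (g : MatField) : Bilin := fun y j l => ∑ i, ∑ k, ginv g y i k * riem g y i j k l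

/-- The scalar curvature `s = g^{jl} r_{jl}`. -/
def scal (g : MatField) (y : E4) : ℝ := ∑ j, ∑ l, ginv g y j l * ricci g y j l

/-- The Weyl curvature `W_{ijkl}` in dimension 4, with index vector `I = ![i, j, k, l]`. -/
def weyl (g : MatField) : CovTensor 4 := fun y I =>
  riem g y (I 0) (I 1) (I 2) (I 3)
    - (1 / 2) * (g y (I 0) (I 2) * ricci g y (I 1) (I 3) - g y (I 0) (I 3) * ricci g y (I 1) (I 2)
      - g y (I 1) (I 2) * ricci g y (I 0) (I 3) + g y (I 1) (I 3) * ricci g y (I 0) (I 2))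
    + (scal g y / 6) * (g y (I 0) (I 2) * g y (I 1) (I 3) - g y (I 0) (I 3) * g y (I 1) (I 2))

/-- The covariant derivative of a covariant tensor field; the new index is the first one:
`cov g T y (i, I) = (∇_i T)_I`. -/
def cov (g : MatField) {k : ℕ} (T : CovTensor k) : CovTensor (k + 1) := fun y I =>
  pd (I 0) (fun z => T z (Fin.tail I)) y
    - ∑ p : Fin k, ∑ m, christoffel g y m (I 0) (I p.succ) *
        T y (Function.update (Fin.tail I) p m)

/-- Both indices raised: `T^{ij} = g^{im} g^{jn} T_{mn}`. -/
def raise (g : MatField) (T : Bilin) : Bilin := fun y i j =>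
  ∑ m, ∑ n, ginv g y i m * ginv g y j n * T y m n

/-- The Bach tensor `B_{ab} = (∇^c ∇^d + (1/2) r^{cd}) W_{acbd}`. -/
def bach (g : MatField) : Bilin := fun y a b =>
  ∑ c, ∑ d, ((∑ m, ∑ n, ginv g y c m * ginv g y d n *
      cov g (cov g (weyl g)) y ![m, n, a, c, b, d])
    + (1 / 2) * raise g (ricci g) y c d * weyl g y ![a, c, b, d])

/-- `T(J·, ·)`, with components `J^c_a T_{cb}`. -/
def appL (J : MatField) (T : Bilin) : Bilin := fun y a b => ∑ c, J y c a * T y c b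

/-- `T(·, J·)`, with components `J^c_b T_{ac}`. -/
def appR (J : MatField) (T : Bilin) : Bilin := fun y a b => ∑ c, J y c b * T y a c

/-- The fundamental form `ω = g(J·, ·)`. -/
def kform (g J : MatField) : Bilin := appL J (fun y a b => g y a b)

/-- The Ricci form `ρ = r(J·, ·)`. -/
def ricciForm (g J : MatField) : Bilin := appL J (ricci g)

/-- The exterior derivative of a 2-form, `(dα)_{abc} = ∂_a α_{bc} + ∂_b α_{ca} + ∂_c α_{ab}`. -/
def extd (α : Bilin) (y : E4) (a b c : Fin 4) : ℝ :=
  pd a (fun z => α z b c) y + pd b (fun z => α z c a) y + pd c (fun z => α z a b) y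

/-- The codifferential of a 2-form, `(δα)_b = -∇^a α_{ab}`. -/
def codiff (g : MatField) (α : Bilin) (y : E4) (b : Fin 4) : ℝ :=
  -∑ a, ∑ m, ginv g y a m * cov g (k := 2) (fun z I => α z (I 0) (I 1)) y ![m, a, b]

/-- The symbol `ε_{ijkl}`: the sign of the permutation `(i, j, k, l)` of `(0, 1, 2, 3)`, and `0` if
two indices coincide. -/
def eps (i j k l : Fin 4) : ℝ :=
  Matrix.det (Matrix.of fun a b : Fin 4 =>
    if (![i, j, k, l] : Fin 4 → Fin 4) a = b then (1 : ℝ) else 0)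

/-- The value of `ω ∧ ω / 2` on `(∂_0, ∂_1, ∂_2, ∂_3)`. -/
def halfSquare (om : Bilin) (y : E4) : ℝ :=
  om y 0 1 * om y 2 3 - om y 0 2 * om y 1 3 + om y 0 3 * om y 1 2

/-- The Riemannian volume form, for the orientation defined by `J`, i.e. the one for which
`ω ∧ ω > 0`. -/
def vol (g J : MatField) (y : E4) (i j k l : Fin 4) : ℝ :=
  Real.sign (halfSquare (kform g J) y) * Real.sqrt (g y).det * eps i j k l

/-- The Hodge star on 2-forms, `(⋆α)_{ij} = (1/2) vol_{ijkl} α^{kl}`. -/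
def hodge (g J : MatField) (α : Bilin) : Bilin := fun y i j =>
  (1 / 2) * ∑ k, ∑ l, vol g J y i j k l * raise g α y k l

/-- The Nijenhuis tensor
`N^a_{bc} = J^d_b ∂_d J^a_c - J^d_c ∂_d J^a_b - J^a_d (∂_b J^d_c - ∂_c J^d_b)`. -/
def nijenhuis (J : MatField) (y : E4) (a b c : Fin 4) : ℝ :=
  ∑ d, (J y d b * pd d (fun z => J z a c) y - J y d c * pd d (fun z => J z a b) y
    - J y a d * (pd b (fun z => J z d c) y - pd c (fun z => J z d b) y))

/-- The gradient `ξ^a = g^{ab} ∂_b f`. -/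
def grad (g : MatField) (f : E4 → ℝ) (y : E4) (a : Fin 4) : ℝ := ∑ b, ginv g y a b * pd b f y

/-- The Lie derivative
`(L_ξ J)^a_b = ξ^c ∂_c J^a_b - J^c_b ∂_c ξ^a + J^a_c ∂_b ξ^c` of an endomorphism field. -/
def lieEnd (ξ : E4 → Fin 4 → ℝ) (J : MatField) (y : E4) (a b : Fin 4) : ℝ :=
  ∑ c, (ξ y c * pd c (fun z => J z a b) y - J y c b * pd c (fun z => ξ z a) y
    + J y a c * pd b (fun z => ξ z c) y)

/-- `∂̄f`, the (0,1)-part `(1/2)(df + i df ∘ J)` of `df`, as a complex 1-form. -/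
def dbar (J : MatField) (f : E4 → ℝ) (y : E4) (b : Fin 4) : ℂ :=
  (1 / 2) * ((pd b f y : ℝ) + Complex.I * ((∑ c, J y c b * pd c f y : ℝ) : ℂ))

/-- The exterior derivative of a complex 1-form. -/
def extdOne (α : E4 → Fin 4 → ℂ) (y : E4) (a b : Fin 4) : ℂ :=
  pd a (fun z => α z b) y - pd b (fun z => α z a) y

/-- The (1,1)-part `(1/2)(β + β(J·, J·))` of a complex 2-form. -/
def part11 (J : MatField) (β : E4 → Fin 4 → Fin 4 → ℂ) (y : E4) (a b : Fin 4) : ℂ :=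
  (1 / 2) * (β y a b + ∑ c, ∑ d, (J y c a : ℂ) * (J y d b : ℂ) * β y c d)

/-- `∂∂̄f`, the (1,1)-part of `d(∂̄f)`. -/
def ddbar (J : MatField) (f : E4 → ℝ) : E4 → Fin 4 → Fin 4 → ℂ := part11 J (extdOne (dbar J f))

/-- The contraction `Λβ = (1/2) ω^{ab} β_{ab}` with the fundamental form. -/
def contr (g J : MatField) (β : E4 → Fin 4 → Fin 4 → ℂ) (y : E4) : ℂ :=
  (1 / 2) * ∑ a, ∑ b, (raise g (kform g J) y a b : ℂ) * β y a b

/-- The projection `β₀ = β - (1/2) (Λβ) ω` of a (1,1)-form to its primitive part (`Λω = 2`). -/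
def primPart (g J : MatField) (β : E4 → Fin 4 → Fin 4 → ℂ) (y : E4) (a b : Fin 4) : ℂ :=
  β y a b - (1 / 2) * contr g J β y * (kform g J y a b : ℂ)

/-- `α` is (on the open set `U`) a smooth real 2-form. -/
def IsTwoForm (U : Set E4) (α : Bilin) : Prop :=
  (∀ a b, ContDiffOn ℝ ∞ (fun y => α y a b) U) ∧ ∀ y ∈ U, ∀ a b, α y b a = -α y a b

/-- `α` is of type (1,1): `α(J·, J·) = α`. -/
def IsType11 (U : Set E4) (J : MatField) (α : Bilin) : Prop :=
  ∀ y ∈ U, ∀ a b, appL J (appR J α) y a b = α y a b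

/-- `α` is harmonic: closed and co-closed. -/
def IsHarmonic (U : Set E4) (g : MatField) (α : Bilin) : Prop :=
  (∀ y ∈ U, ∀ a b c, extd α y a b c = 0) ∧ ∀ y ∈ U, ∀ b, codiff g α y b = 0

/-- `α` is anti-self-dual: `⋆α = -α`. -/
def IsASD (U : Set E4) (g J : MatField) (α : Bilin) : Prop :=
  ∀ y ∈ U, ∀ a b, hodge g J α y a b = -α y a b

end Coord

/-! ## Kähler surfaces -/

section Manifold

variable {M : Type*} [TopologicalSpace M] [ChartedSpace E4 M]

/-- The coordinate vector `∂_i` of the chart `e`, at the point with coordinates `y`. -/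
def coordVec (e : OpenPartialHomeomorph M E4) (y : E4) (i : Fin 4) :
    TangentSpace (𝓡 4) (e.symm y) :=
  mfderiv (𝓡 4) (𝓡 4) e.symm y (EuclideanSpace.single i (1 : ℝ) : E4)

/-- The components `g(∂_i, ∂_j)` of a Riemannian metric in the chart `e`. -/
def metricIn [IsManifold (𝓡 4) ∞ M]
    (g : Bundle.ContMDiffRiemannianMetric (𝓡 4) ∞ E4 (fun x : M => TangentSpace (𝓡 4) x))
    (e : OpenPartialHomeomorph M E4) : Coord.MatField := fun y =>
  Matrix.of fun i j => g.inner (e.symm y) (coordVec e y i) (coordVec e y j)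

/-- The components `J^a_b` of a field of endomorphisms of the tangent bundle in the chart `e`. -/
def endIn (J : ∀ x : M, TangentSpace (𝓡 4) x →L[ℝ] TangentSpace (𝓡 4) x)
    (e : OpenPartialHomeomorph M E4) : Coord.MatField := fun y =>
  Matrix.of fun a b =>
    let v : E4 := mfderiv (𝓡 4) (𝓡 4) e (e.symm y) (J (e.symm y) (coordVec e y b))
    v a

end Manifold

/-- A Kähler surface `(M⁴, g, J)`: a smooth 4-manifold with a Riemannian metric `g` and an
integrable almost complex structure `J` such that `g` is Hermitian and the fundamental form
`ω = g(J·, ·)` is closed. -/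
structure KahlerSurface (M : Type*) [TopologicalSpace M] [ChartedSpace E4 M]
    [IsManifold (𝓡 4) ∞ M] where
  /-- the metric -/
  g : Bundle.ContMDiffRiemannianMetric (𝓡 4) ∞ E4 (fun x : M => TangentSpace (𝓡 4) x)
  /-- the complex structure -/
  J : ∀ x : M, TangentSpace (𝓡 4) x →L[ℝ] TangentSpace (𝓡 4) x
  contMDiff_J : ContMDiff (𝓡 4) ((𝓡 4).prod 𝓘(ℝ, E4 →L[ℝ] E4)) ∞
    (fun x => Bundle.TotalSpace.mk' (E4 →L[ℝ] E4)
      (E := fun x : M => TangentSpace (𝓡 4) x →L[ℝ] TangentSpace (𝓡 4) x) x (J x))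
  J_sq : ∀ x v, J x (J x v) = -v
  hermitian : ∀ x v w, g.inner x (J x v) (J x w) = g.inner x v w
  integrable : ∀ e ∈ IsManifold.maximalAtlas (𝓡 4) ∞ M, ∀ y ∈ e.target, ∀ a b c,
    Coord.nijenhuis (endIn J e) y a b c = 0
  closed : ∀ e ∈ IsManifold.maximalAtlas (𝓡 4) ∞ M, ∀ y ∈ e.target, ∀ a b c,
    Coord.extd (Coord.kform (metricIn g e) (endIn J e)) y a b c = 0

/-- A Kähler metric is extremal if `grad^{1,0} s` is a holomorphic vector field, `s` being the
scalar curvature; equivalently, the flow of the real vector field `grad s` preserves `J`, i.e.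
`L_{grad s} J = 0`. -/
def KahlerSurface.IsExtremal {M : Type*} [TopologicalSpace M] [ChartedSpace E4 M]
    [IsManifold (𝓡 4) ∞ M] (K : KahlerSurface M) : Prop :=
  ∀ e ∈ IsManifold.maximalAtlas (𝓡 4) ∞ M, ∀ y ∈ e.target, ∀ a b,
    Coord.lieEnd (Coord.grad (metricIn K.g e) (Coord.scal (metricIn K.g e))) (endIn K.J e) y a b = 0

end

noncomputable section

/-! The statement is local. In a chart, the smooth functions on the open target form a commutative
ℝ-algebra with four commuting derivations, and nearly all of the tensor calculus consists of
identities in such an algebra, provable by expansion and `ring`. The abstract identities are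
evaluated at points only at the end. The multiples `weyl12`, `bach24`, `psi24` keep denominators out
of the algebra.

For any metric, the second Bianchi identity expresses ∇^d W_{acbd} through ∇r and ds
(`cotton12_eq`), so ∇^c∇^d W_{acbd} involves ∇^c∇_c r_{ab}, ∇^c∇_a r_{cb}, Hess s and Δs
(`div_cotton12`). Commuting derivatives turns ∇^c∇_a r_{cb} into Hess s / 2 plus the quadratic terms
r² and R·r (`two_divGradRic`).

For a Kähler metric J is parallel (`cJ_zero`), so ρ is closed (`cyclic_c2_rho`). This lets the
derivative index of ∇r be exchanged with another one, and gives ∇^c∇_c r as ∇^c∇_a r_{cb} plus its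
J-conjugate (`lapRic_eq`). Extremality says exactly that Hess s is J-invariant (`hess_jj`); then
∇^c∇_a r_{cb} is J-invariant too, and the rough Laplacian of r is twice it. In the Bach tensor R·r
cancels against W·r, and r² is eliminated by the quadratic equation of the complex linear Ricci
endomorphism (`ricSq_eq`). What remains is 24 B = 8 Hess s + 4 s r - (s² + 2 Δs) g (`bach_formula`),
which composed with J is the asserted formula, as 2i∂∂̄s = 2 Hess s(J·,·).

This B is symmetric, J-invariant and trace-free, so ψ is a primitive (1,1)-form; in dimension 4 such
forms are anti-self-dual (`star_primitive`). B is divergence-free because grad s satisfies ∇^a∇_a∇_b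
s = -r_{bc}∇^c s (`div_hess`, `div_bach24`), whence δψ = 0. Closedness follows because contraction
of dψ with the nondegenerate bivector J g⁻¹ vanishes, and this contraction is injective on 3-forms
in dimension 4 (`pfaffian_mul_cyclic`). -/

/-- A metric `g` with inverse `gi` over a commutative ring with four commuting derivations. -/
structure MetricAlg (A : Type*) [CommRing A] [Algebra ℝ A] where
  /-- the partial derivatives -/
  D : Fin 4 → Derivation ℝ A A
  D_comm : ∀ i j f, D i (D j f) = D j (D i f)
  /-- the metric -/
  g : Fin 4 → Fin 4 → A
  /-- the inverse metric -/
  gi : Fin 4 → Fin 4 → A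
  g_symm : ∀ a b, g a b = g b a
  gi_symm : ∀ a b, gi a b = gi b a
  g_gi : ∀ a b, ∑ c, g a c * gi c b = if a = b then 1 else 0

namespace MetricAlg

/-! ### Levi-Civita connection and curvature identities over a differential ring. -/

section Basic

/-- Rings of smooth functions have zero divisors, so 2 is cancelled by multiplying with its inverse,
which comes from ℝ. -/
theorem cancel_two {A : Type*} [CommRing A] [Algebra ℝ A] {x y : A} (h : 2 * x = 2 * y) :
    x = y := by
  have h2 : (algebraMap ℝ A (1 / 2)) * 2 = 1 := by
    rw [← map_ofNat (algebraMap ℝ A) 2, ← map_mul]; norm_num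
  linear_combination (algebraMap ℝ A (1 / 2)) * h + (y - x) * h2

variable {A : Type*} [CommRing A] [Algebra ℝ A] (K : MetricAlg A)

theorem gi_g (a b : Fin 4) : ∑ c, K.gi a c * K.g c b = if a = b then 1 else 0 := by
  rw [← ite_congr (propext (eq_comm (a := b) (b := a))) (fun _ => rfl) (fun _ => rfl), ← K.g_gi b a]
  exact Finset.sum_congr rfl fun c _ => by rw [K.gi_symm, K.g_symm, mul_comm]

/-- Christoffel symbols. -/
def Γ (k i j : Fin 4) : A :=
  (1 / 2 : ℝ) • ∑ l, K.gi k l * (K.D i (K.g j l) + K.D j (K.g i l) - K.D l (K.g i j))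

theorem Γ_symm (k i j : Fin 4) : K.Γ k i j = K.Γ k j i := by
  unfold Γ
  congr 1
  refine Finset.sum_congr rfl fun l _ => ?_
  rw [K.g_symm i j]; ring

/-- Lowering a raised index. -/
theorem lower_raise (f : Fin 4 → A) (k : Fin 4) :
    ∑ m, K.g k m * ∑ l, K.gi m l * f l = f k := by
  simp_rw [Finset.mul_sum]
  rw [Finset.sum_comm]
  simp_rw [← mul_assoc, ← Finset.sum_mul, K.g_gi]
  simp

theorem raise_lower (f : Fin 4 → A) (k : Fin 4) :
    ∑ m, K.gi k m * ∑ l, K.g m l * f l = f k := by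
  simp_rw [Finset.mul_sum]
  rw [Finset.sum_comm]
  simp_rw [← mul_assoc, ← Finset.sum_mul, K.gi_g]
  simp

theorem lower_Γ (k i j : Fin 4) : ∑ m, K.g k m * (2 * K.Γ m i j) =
    K.D i (K.g j k) + K.D j (K.g i k) - K.D k (K.g i j) := by
  rw [← K.lower_raise (fun k => K.D i (K.g j k) + K.D j (K.g i k) - K.D k (K.g i j)) k]
  refine Finset.sum_congr rfl fun m _ => ?_
  unfold Γ
  rw [two_mul, ← add_smul]; norm_num

/-- Metric compatibility. Used as a rewrite rule, it removes all derivatives of `g` from an expanded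
covariant derivative, after which `ring` can finish. -/
theorem D_g (i j k : Fin 4) :
    K.D i (K.g j k) = ∑ m, K.Γ m i j * K.g m k + ∑ m, K.Γ m i k * K.g j m := by
  apply cancel_two
  have h1 := K.lower_Γ k i j
  have h2 := K.lower_Γ j i k
  have e1 : ∑ m, K.Γ m i j * K.g m k = ∑ m, K.g k m * K.Γ m i j :=
    Finset.sum_congr rfl fun m _ => by rw [K.g_symm m k, mul_comm]
  have e2 : ∑ m, K.Γ m i k * K.g j m = ∑ m, K.g j m * K.Γ m i k :=
    Finset.sum_congr rfl fun m _ => by rw [mul_comm]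
  have f : ∀ a b c, ∑ m, K.g a m * (2 * K.Γ m b c) = 2 * ∑ m, K.g a m * K.Γ m b c := by
    intro a b c
    rw [Finset.mul_sum]; exact Finset.sum_congr rfl fun m _ => by ring
  rw [f] at h1 h2
  rw [e1, e2, mul_add, h1, h2, K.g_symm k j]
  ring

/-! ### Covariant derivatives -/

/-- Covariant derivative of a 1-form. -/
def c1 (T : Fin 4 → A) (i a : Fin 4) : A := K.D i (T a) - ∑ m, K.Γ m i a * T m

/-- Covariant derivative of a covariant tensor of rank 2. -/
def c2 (T : Fin 4 → Fin 4 → A) (i a b : Fin 4) : A :=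
  K.D i (T a b) - ∑ m, K.Γ m i a * T m b - ∑ m, K.Γ m i b * T a m

/-- Covariant derivative of a covariant tensor of rank 3. -/
def c3 (T : Fin 4 → Fin 4 → Fin 4 → A) (i a b c : Fin 4) : A :=
  K.D i (T a b c) - ∑ m, K.Γ m i a * T m b c - ∑ m, K.Γ m i b * T a m c
    - ∑ m, K.Γ m i c * T a b m

/-- Covariant derivative of a covariant tensor of rank 4. -/
def c4 (T : Fin 4 → Fin 4 → Fin 4 → Fin 4 → A) (i a b c d : Fin 4) : A :=
  K.D i (T a b c d) - ∑ m, K.Γ m i a * T m b c d - ∑ m, K.Γ m i b * T a m c d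
    - ∑ m, K.Γ m i c * T a b m d - ∑ m, K.Γ m i d * T a b c m

/-- Covariant derivative of a covariant tensor of rank 5. -/
def c5 (T : Fin 4 → Fin 4 → Fin 4 → Fin 4 → Fin 4 → A) (i a b c d e : Fin 4) : A :=
  K.D i (T a b c d e) - ∑ m, K.Γ m i a * T m b c d e - ∑ m, K.Γ m i b * T a m c d e
    - ∑ m, K.Γ m i c * T a b m d e - ∑ m, K.Γ m i d * T a b c m e - ∑ m, K.Γ m i e * T a b c d m

theorem c2_g (i a b : Fin 4) : K.c2 K.g i a b = 0 := by
  unfold c2; rw [D_g]; ring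

/-- The curvature `R^l_{kij}`. -/
def Rup (l k i j : Fin 4) : A :=
  K.D i (K.Γ l j k) - K.D j (K.Γ l i k)
    + ∑ m, (K.Γ l i m * K.Γ m j k - K.Γ l j m * K.Γ m i k)

/-- The curvature with lowered index. -/
def Rm (i j k l : Fin 4) : A := ∑ m, K.g k m * K.Rup m l i j

/-- After expansion the second derivatives cancel because the derivations commute, and the remaining
first-order terms cancel because the connection is torsion-free. -/
theorem ricci_identity_one (T : Fin 4 → A) (i j a : Fin 4) :
    K.c2 (K.c1 T) i j a - K.c2 (K.c1 T) j i a = -∑ l, K.Rup l a i j * T l := by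
  simp only [c1, c2, Rup, Fin.sum_univ_four, map_sub, map_add, Derivation.leibniz, smul_eq_mul]
  rw [K.D_comm i j]
  simp only [K.Γ_symm _ j i]
  ring

theorem ricci_identity_two (T : Fin 4 → Fin 4 → A) (i j a b : Fin 4) :
    K.c3 (K.c2 T) i j a b - K.c3 (K.c2 T) j i a b
      = -∑ l, K.Rup l a i j * T l b - ∑ l, K.Rup l b i j * T a l := by
  simp only [c3, c2, Rup, Fin.sum_univ_four, map_sub, map_add, Derivation.leibniz, smul_eq_mul]
  rw [K.D_comm i j]
  simp only [K.Γ_symm _ j i]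
  ring

theorem Rup_antisymm (l k i j : Fin 4) : K.Rup l k j i = -K.Rup l k i j := by
  simp only [Rup, Fin.sum_univ_four]; ring

theorem Rup_bianchi (l i j k : Fin 4) : K.Rup l k i j + K.Rup l i j k + K.Rup l j k i = 0 := by
  simp only [Rup, Fin.sum_univ_four]
  rw [K.Γ_symm l i k, K.Γ_symm l j i, K.Γ_symm l k j]
  simp only [K.Γ_symm _ j i, K.Γ_symm _ k j, K.Γ_symm _ k i]
  ring

theorem c3_zero (i a b c : Fin 4) : K.c3 (fun _ _ _ => 0) i a b c = 0 := by
  simp [c3]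

theorem Rm_antisymm₁ (i j k l : Fin 4) : K.Rm j i k l = -K.Rm i j k l := by
  simp only [Rm, K.Rup_antisymm _ _ i j, mul_neg, Finset.sum_neg_distrib]

/-- This is the Ricci identity applied to the parallel tensor `g`. -/
theorem Rm_antisymm₂ (i j k l : Fin 4) : K.Rm i j l k = -K.Rm i j k l := by
  have h := K.ricci_identity_two K.g i j k l
  have h0 : K.c2 K.g = fun _ _ _ => 0 := by funext i a b; exact K.c2_g i a b
  rw [h0, c3_zero, c3_zero] at h
  have e1 : ∑ m, K.Rup m k i j * K.g m l = K.Rm i j l k :=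
    Finset.sum_congr rfl fun m _ => by rw [K.g_symm m l, mul_comm]
  have e2 : ∑ m, K.Rup m l i j * K.g k m = K.Rm i j k l :=
    Finset.sum_congr rfl fun m _ => by rw [mul_comm]
  rw [e1, e2] at h
  linear_combination h

theorem Rm_bianchi (i j k l : Fin 4) : K.Rm i j l k + K.Rm j k l i + K.Rm k i l j = 0 := by
  simp only [Rm, ← Finset.sum_add_distrib, ← mul_add, K.Rup_bianchi, mul_zero,
    Finset.sum_const_zero]

/-- The classical octahedron argument: a signed sum of the four first Bianchi identities, each with
a different index held fixed, reduced by the two antisymmetries. -/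
theorem Rm_pair (i j k l : Fin 4) : K.Rm i j k l = K.Rm k l i j := by
  have b := K.Rm_bianchi
  have a1 := K.Rm_antisymm₁
  have a2 := K.Rm_antisymm₂
  apply cancel_two
  linear_combination -b i j k l + a2 i j k l + a2 j k i l + a2 k i j l - a1 i k j l
    - b j k l i + a1 j l i k + b k l i j - a2 k l i j - a1 i l j k
    + b l i j k - a2 l i j k + a1 i l j k - a2 j l i k

theorem Rm_bianchi_first (i j k l : Fin 4) : K.Rm i j k l + K.Rm j k i l + K.Rm k i j l = 0 := by
  linear_combination K.Rm_antisymm₂ i j l k + K.Rm_antisymm₂ j k l i + K.Rm_antisymm₂ k i l j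
    - K.Rm_bianchi i j k l

/-- Covariant derivative of a tensor whose first index is an upper one. -/
def cUp (T : Fin 4 → Fin 4 → Fin 4 → Fin 4 → A) (e l k i j : Fin 4) : A :=
  K.D e (T l k i j) + ∑ m, K.Γ l e m * T m k i j - ∑ m, K.Γ m e k * T l m i j
    - ∑ m, K.Γ m e i * T l k m j - ∑ m, K.Γ m e j * T l k i m

-- The upper-index curvature is polynomial in `Γ` and its first derivatives, with no metric
-- involved, so the identity is a formal consequence of commuting derivations and the symmetry of
-- `Γ`. The index is lowered afterwards by `c4_Rm`.
set_option maxHeartbeats 1000000 in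
theorem Rup_bianchi_second (l k e i j : Fin 4) :
    K.cUp K.Rup e l k i j + K.cUp K.Rup i l k j e + K.cUp K.Rup j l k e i = 0 := by
  simp only [cUp, Rup, Fin.sum_univ_four, map_sub, map_add, Derivation.leibniz, smul_eq_mul]
  rw [K.D_comm j i, K.D_comm j e, K.D_comm i e]
  simp only [K.Γ_symm _ j i, K.Γ_symm _ i e, K.Γ_symm _ j e]
  ring

theorem c4_Rm (e i j k l : Fin 4) :
    K.c4 K.Rm e i j k l = ∑ m, K.g k m * K.cUp K.Rup e m l i j := by
  simp only [c4, cUp, Rm, Fin.sum_univ_four, map_add, Derivation.leibniz, smul_eq_mul, K.D_g]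
  ring

theorem Rm_bianchi_second (e i j k l : Fin 4) :
    K.c4 K.Rm e i j k l + K.c4 K.Rm i j e k l + K.c4 K.Rm j e i k l = 0 := by
  simp only [c4_Rm, ← Finset.sum_add_distrib, ← mul_add, Rup_bianchi_second, mul_zero,
    Finset.sum_const_zero]

end Basic
end MetricAlg

namespace MetricAlg

/-! ### Metric traces and their compatibility with the connection. -/

section Trace

variable {A : Type*} [CommRing A] [Algebra ℝ A] (K : MetricAlg A)

/-- The trace of a covariant tensor of rank 2 with respect to the metric. -/
def tr (T : Fin 4 → Fin 4 → A) : A := ∑ i, ∑ j, K.gi i j * T i j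

theorem tr_add (S T : Fin 4 → Fin 4 → A) :
    K.tr (fun i j => S i j + T i j) = K.tr S + K.tr T := by
  simp only [tr, mul_add, Finset.sum_add_distrib]

theorem tr_sub (S T : Fin 4 → Fin 4 → A) :
    K.tr (fun i j => S i j - T i j) = K.tr S - K.tr T := by
  simp only [tr, mul_sub, Finset.sum_sub_distrib]

theorem tr_neg (T : Fin 4 → Fin 4 → A) : K.tr (fun i j => -T i j) = -K.tr T := by
  simp only [tr, mul_neg, Finset.sum_neg_distrib]

theorem tr_mul_left (a : A) (T : Fin 4 → Fin 4 → A) :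
    K.tr (fun i j => a * T i j) = a * K.tr T := by
  simp only [tr, Finset.mul_sum]
  exact Finset.sum_congr rfl fun i _ => Finset.sum_congr rfl fun j _ => by ring

theorem tr_mul_right (a : A) (T : Fin 4 → Fin 4 → A) :
    K.tr (fun i j => T i j * a) = K.tr T * a := by
  simp only [mul_comm _ a, tr_mul_left]

theorem tr_zero : K.tr (fun _ _ => 0) = 0 := by simp [tr]

theorem tr_sum (T : Fin 4 → Fin 4 → Fin 4 → A) :
    K.tr (fun i j => ∑ m, T m i j) = ∑ m, K.tr (T m) := by
  simp only [tr, Finset.mul_sum]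
  rw [Finset.sum_comm]
  simp only [Fin.sum_univ_four]
  ring

theorem tr_swap (T : Fin 4 → Fin 4 → A) : K.tr (fun i j => T j i) = K.tr T := by
  unfold tr
  rw [Finset.sum_comm]
  simp only [K.gi_symm]

theorem tr_tr (T : Fin 4 → Fin 4 → Fin 4 → Fin 4 → A) :
    K.tr (fun i j => K.tr (T i j)) = K.tr (fun k l => K.tr fun i j => T i j k l) := by
  simp only [tr, Fin.sum_univ_four]; ring

theorem tr_g_right (X : Fin 4 → A) (a : Fin 4) : K.tr (fun i j => K.g a j * X i) = X a := by
  have h := K.lower_raise X a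
  rw [← h]
  simp only [tr, Fin.sum_univ_four]; simp only [K.gi_symm]; ring

theorem tr_g : K.tr K.g = 4 := by
  have h : K.tr K.g = ∑ i, ∑ j, K.gi i j * K.g j i := by
    unfold tr; simp only [K.g_symm]
  rw [h]
  simp only [gi_g]
  simp

/-- Differentiating g g⁻¹ = 1 and inserting `D_g` gives the derivative of the inverse metric, which
says that g⁻¹ is parallel; contracting with `T` gives the claim. -/
theorem tr_D_gi (k : Fin 4) (T : Fin 4 → Fin 4 → A) :
    ∑ i, ∑ j, K.D k (K.gi i j) * T i j =
      -K.tr (fun i j => ∑ m, K.Γ m k i * T m j) - K.tr (fun i j => ∑ m, K.Γ m k j * T i m) := by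
  have key : ∀ i j, K.D k (K.gi i j) =
      -∑ m, K.Γ i k m * K.gi m j - ∑ m, K.Γ j k m * K.gi i m := by
    intro i j
    have h1 : ∀ a, ∑ c, (K.D k (K.g a c) * K.gi c j + K.g a c * K.D k (K.gi c j)) = 0 := by
      intro a
      have h := congrArg (K.D k) (K.g_gi a j)
      rw [map_sum] at h
      have h0 : K.D k (if a = j then (1 : A) else 0) = 0 := by split_ifs <;> simp
      rw [h0] at h
      rw [← h]
      refine Finset.sum_congr rfl fun c _ => ?_
      rw [Derivation.leibniz]; simp only [smul_eq_mul]; ring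
    have h2 : ∑ a, K.gi i a * ∑ c, K.g a c * K.D k (K.gi c j) = K.D k (K.gi i j) :=
      K.raise_lower (fun c => K.D k (K.gi c j)) i
    have h3 : ∀ a, ∑ c, K.g a c * K.D k (K.gi c j) =
        -∑ m, K.Γ m k a * (if m = j then 1 else 0)
          - ∑ m, K.g a m * ∑ c, K.Γ m k c * K.gi c j := by
      intro a
      have := h1 a
      rw [Finset.sum_add_distrib] at this
      rw [eq_neg_of_add_eq_zero_right this, ← neg_add']
      congr 1
      simp only [← K.g_gi, K.D_g, Fin.sum_univ_four]
      ring
    rw [← h2]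
    simp only [h3]
    have h4 : ∑ a, K.gi i a * ∑ m, K.g a m * ∑ c, K.Γ m k c * K.gi c j
        = ∑ c, K.Γ i k c * K.gi c j :=
      K.raise_lower (fun m => ∑ c, K.Γ m k c * K.gi c j) i
    simp only [mul_sub, Finset.sum_sub_distrib, h4]
    simp only [mul_ite, mul_one, mul_zero, Finset.sum_ite_eq', Finset.mem_univ, if_true, mul_neg,
      Finset.sum_neg_distrib]
    rw [neg_sub_left, neg_sub_left, add_comm]
    simp only [mul_comm]
  simp only [key, tr, Fin.sum_univ_four]
  ring

/-- Parallelism of g⁻¹ in the form used everywhere below: covariant differentiation commutes with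
contraction. -/
theorem D_tr (k : Fin 4) (T : Fin 4 → Fin 4 → A) : K.D k (K.tr T) = K.tr (K.c2 T k) := by
  have h : K.D k (K.tr T) = ∑ i, ∑ j, K.D k (K.gi i j) * T i j
      + K.tr (fun i j => K.D k (T i j)) := by
    simp only [tr, map_sum, Derivation.leibniz, smul_eq_mul, ← Finset.sum_add_distrib]
    exact Finset.sum_congr rfl fun i _ => Finset.sum_congr rfl fun j _ => by ring
  rw [h, tr_D_gi]
  have : K.tr (K.c2 T k) = K.tr (fun i j => K.D k (T i j) - ∑ m, K.Γ m k i * T m j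
    - ∑ m, K.Γ m k j * T i m) := rfl
  rw [this, tr_sub, tr_sub]
  ring

end Trace

/-! ### Contracted Bianchi identities and the double divergence of the Weyl tensor, for an arbitrary
metric. -/

section Ricci

variable {A : Type*} [CommRing A] [Algebra ℝ A] (K : MetricAlg A)

/-- The Ricci tensor. -/
def ric (j l : Fin 4) : A := K.tr fun i k => K.Rm i j k l

/-- The scalar curvature. -/
def sc : A := K.tr K.ric

/-- The differential of the scalar curvature. -/
def ds (i : Fin 4) : A := K.D i K.sc

/-- The Hessian of the scalar curvature. -/
def hess (i j : Fin 4) : A := K.c1 K.ds i j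

theorem ric_symm (a b : Fin 4) : K.ric a b = K.ric b a := by
  unfold ric
  rw [← tr_swap]
  congr 1; funext i j; rw [Rm_pair]

theorem hess_symm (a b : Fin 4) : K.hess a b = K.hess b a := by
  unfold hess c1 ds
  rw [K.D_comm]
  simp only [K.Γ_symm _ a b]

theorem c2_symm (T : Fin 4 → Fin 4 → A) (hT : ∀ a b, T a b = T b a) (i a b : Fin 4) :
    K.c2 T i a b = K.c2 T i b a := by
  unfold c2
  rw [hT a b, sub_right_comm]
  simp only [hT]

theorem c3_symm (T : Fin 4 → Fin 4 → Fin 4 → A) (hT : ∀ c a b, T c a b = T c b a)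
    (i c a b : Fin 4) : K.c3 T i c a b = K.c3 T i c b a := by
  unfold c3
  rw [hT c a b, sub_right_comm]
  simp only [fun m => hT m a b, fun m => hT c m b, fun m => hT c a m]

theorem c2_ric_symm (i a b : Fin 4) : K.c2 K.ric i a b = K.c2 K.ric i b a :=
  K.c2_symm _ K.ric_symm i a b

theorem c4_Rm_antisymm₁ (e i j k l : Fin 4) : K.c4 K.Rm e j i k l = -K.c4 K.Rm e i j k l := by
  simp only [c4, fun m => K.Rm_antisymm₁ i m k l, fun m => K.Rm_antisymm₁ m j k l,
    fun m => K.Rm_antisymm₁ i j m l, fun m => K.Rm_antisymm₁ i j k m,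
    map_neg, mul_neg, Finset.sum_neg_distrib]
  ring

theorem c4_Rm_antisymm₂ (e i j k l : Fin 4) : K.c4 K.Rm e i j l k = -K.c4 K.Rm e i j k l := by
  simp only [c4, fun m => K.Rm_antisymm₂ m j k l, fun m => K.Rm_antisymm₂ i m k l,
    fun m => K.Rm_antisymm₂ i j m l, fun m => K.Rm_antisymm₂ i j k m,
    map_neg, mul_neg, Finset.sum_neg_distrib]
  ring

theorem c4_Rm_pair (e i j k l : Fin 4) : K.c4 K.Rm e i j k l = K.c4 K.Rm e k l i j := by
  simp only [c4, fun m => K.Rm_pair m j k l, fun m => K.Rm_pair i m k l,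
    fun m => K.Rm_pair i j m l, fun m => K.Rm_pair i j k m]
  ring

theorem c2_ric (e j l : Fin 4) : K.c2 K.ric e j l = K.tr fun i k => K.c4 K.Rm e i j k l := by
  have h : (K.tr fun i k => K.c4 K.Rm e i j k l) = K.tr fun i k =>
      K.c2 (fun i k => K.Rm i j k l) e i k - ∑ m, K.Γ m e j * K.Rm i m k l
        - ∑ m, K.Γ m e l * K.Rm i j k m := by
    congr 1; funext i k; simp only [c4, c2]; ring
  rw [h, tr_sub, tr_sub, ← D_tr, tr_sum, tr_sum]
  simp only [tr_mul_left]
  rfl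

theorem D_sc (e : Fin 4) : K.ds e = K.tr (K.c2 K.ric e) := K.D_tr e K.ric

/-- `∇^d R_{acbd} = ∇_c r_{ab} - ∇_a r_{cb}`. -/
theorem div_Rm (a c b : Fin 4) :
    (K.tr fun n d => K.c4 K.Rm n a c b d) = K.c2 K.ric c a b - K.c2 K.ric a c b := by
  have h : (K.tr fun n d => K.c4 K.Rm n a c b d) =
      K.tr fun n d => K.c4 K.Rm c n a d b - K.c4 K.Rm a n c d b := by
    congr 1; funext n d
    -- The second Bianchi identity cycles `n`, `a`, `c`; antisymmetry in both pairs puts `n`, `d`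
    -- into the slots whose trace is Ricci.
    linear_combination K.Rm_bianchi_second n a c b d - K.c4_Rm_antisymm₁ a n c b d
      + K.c4_Rm_antisymm₂ a n c d b - K.c4_Rm_antisymm₂ c n a d b
  rw [h, tr_sub, ← c2_ric, ← c2_ric]

/-- The double trace of ∇R is computed in two orders: one gives the divergence formula `div_Rm`, the
other the divergence of Ricci. -/
theorem two_div_ric (c : Fin 4) : 2 * K.tr (fun n d => K.c2 K.ric n d c) = K.ds c := by
  have h1 : (K.tr fun a b => K.tr fun n d => K.c4 K.Rm n a c b d)
      = K.ds c - K.tr (fun a b => K.c2 K.ric a c b) := by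
    simp only [div_Rm, tr_sub]
    rw [D_sc]
  rw [tr_tr] at h1
  have h2 : (K.tr fun n d => K.tr fun a b => K.c4 K.Rm n a c b d)
      = K.tr fun n d => K.c2 K.ric n c d := by
    congr 1; funext n d; rw [c2_ric]
  have h3 : (K.tr fun n d => K.c2 K.ric n c d) = K.tr fun n d => K.c2 K.ric n d c := by
    congr 1; funext n d; rw [c2_ric_symm]
  rw [h2, h3] at h1
  linear_combination h1

/-- `X_{ab} = ∇^c ∇_a r_{cb}`. -/
def divGradRic (a b : Fin 4) : A := K.tr fun m c => K.c3 (K.c2 K.ric) m a c b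

/-- The square of the Ricci tensor. -/
def ricSq (a b : Fin 4) : A := K.tr fun k l => K.ric a k * K.ric l b

/-- The contraction `R_{macb}r^{mc}`. -/
def RmRic (a b : Fin 4) : A := K.tr fun m c => K.tr fun k l => K.Rm m a k b * K.ric c l

theorem Rup_eq (l k i j : Fin 4) : K.Rup l k i j = ∑ m, K.gi l m * K.Rm i j m k :=
  (K.raise_lower (fun m => K.Rup m k i j) l).symm

/-- Exchanging the two derivatives leaves ∇_a of the divergence of Ricci, which is Hess s / 2 by the
contracted Bianchi identity. The commutator contributes one curvature term for each index of Ricci: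
the contracted index gives r², the free one gives R·r. -/
theorem two_divGradRic (a b : Fin 4) :
    2 * K.divGradRic a b = K.hess a b + 2 * K.ricSq a b - 2 * K.RmRic a b := by
  have h : K.divGradRic a b = K.tr fun m c => K.c3 (K.c2 K.ric) a m c b
      - ∑ l, K.Rup l c m a * K.ric l b - ∑ l, K.Rup l b m a * K.ric c l := by
    unfold divGradRic
    congr 1; funext m c
    linear_combination K.ricci_identity_two K.ric m a c b
  rw [h, tr_sub, tr_sub]
  have h1 : 2 * (K.tr fun m c => K.c3 (K.c2 K.ric) a m c b) = K.hess a b := by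
    have : (K.tr fun m c => K.c3 (K.c2 K.ric) a m c b)
        = K.c1 (fun b => K.tr fun m c => K.c2 K.ric m c b) a b := by
      have e : (K.tr fun m c => K.c3 (K.c2 K.ric) a m c b) = K.tr fun m c =>
          K.c2 (fun m c => K.c2 K.ric m c b) a m c - ∑ l, K.Γ l a b * K.c2 K.ric m c l := by
        rfl
      rw [e, tr_sub, tr_sum, ← D_tr]
      simp only [tr_mul_left, c1]
    rw [this]
    have e2 : K.ds = fun b => 2 * K.tr fun m c => K.c2 K.ric m c b := by
      funext b; exact (K.two_div_ric b).symm
    rw [hess, e2]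
    simp only [c1, two_mul, map_add, mul_add, Finset.sum_add_distrib]
    ring
  have h2 : (K.tr fun m c => ∑ l, K.Rup l c m a * K.ric l b) = -K.ricSq a b := by
    have : (fun m c => ∑ l, K.Rup l c m a * K.ric l b) =
        fun m c => K.tr fun k l => K.Rm m a k c * K.ric l b := by
      funext m c
      simp only [Rup_eq, tr, Fin.sum_univ_four]
      simp only [K.gi_symm 1 0, K.gi_symm 2 0, K.gi_symm 3 0, K.gi_symm 2 1, K.gi_symm 3 1,
        K.gi_symm 3 2]
      ring
    rw [this, tr_tr, ricSq, ← tr_neg]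
    congr 1; funext k l
    rw [tr_mul_right, ← neg_mul]
    congr 1
    rw [ric_symm, ric, ← tr_neg, ← tr_swap]
    congr 1; funext i j
    rw [K.Rm_antisymm₂, K.Rm_pair]
  have h3 : (K.tr fun m c => ∑ l, K.Rup l b m a * K.ric c l) = K.RmRic a b := by
    unfold RmRic
    congr 1; funext m c
    simp only [Rup_eq, tr, Fin.sum_univ_four]
    simp only [K.gi_symm 1 0, K.gi_symm 2 0, K.gi_symm 3 0, K.gi_symm 2 1, K.gi_symm 3 1,
        K.gi_symm 3 2]
    ring
  rw [h2, h3]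
  linear_combination h1

/-- Twelve times the Weyl tensor. -/
def weyl12 (i j k l : Fin 4) : A :=
  12 * K.Rm i j k l - 6 * (K.g i k * K.ric j l - K.g i l * K.ric j k - K.g j k * K.ric i l
    + K.g j l * K.ric i k) + 2 * K.sc * (K.g i k * K.g j l - K.g i l * K.g j k)

theorem D_two (i : Fin 4) : K.D i 2 = 0 := by exact_mod_cast (K.D i).map_natCast 2

theorem D_six (i : Fin 4) : K.D i 6 = 0 := by exact_mod_cast (K.D i).map_natCast 6

theorem D_twelve (i : Fin 4) : K.D i 12 = 0 := by exact_mod_cast (K.D i).map_natCast 12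

theorem c4_weyl12 (n i j k l : Fin 4) : K.c4 K.weyl12 n i j k l =
    12 * K.c4 K.Rm n i j k l - 6 * (K.g i k * K.c2 K.ric n j l - K.g i l * K.c2 K.ric n j k
      - K.g j k * K.c2 K.ric n i l + K.g j l * K.c2 K.ric n i k)
    + 2 * K.ds n * (K.g i k * K.g j l - K.g i l * K.g j k) := by
  simp only [c4, weyl12, c2, ds, map_sub, map_add, Derivation.leibniz, smul_eq_mul, D_g,
    Fin.sum_univ_four, D_two, D_six, D_twelve]
  ring

/-- Twelve times the divergence of the Weyl tensor on its last index. -/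
def cotton12 (a c b : Fin 4) : A := K.tr fun n d => K.c4 K.weyl12 n a c b d

/-- The divergence of the Riemann term is `div_Rm`, those of the trace terms reduce to ∇r and ds by
`two_div_ric`. The coefficient 6 is 12 (n - 3)/(n - 2) for n = 4. -/
theorem cotton12_eq (a c b : Fin 4) : K.cotton12 a c b =
    6 * (K.c2 K.ric c a b - K.c2 K.ric a c b) - (K.g a b * K.ds c - K.g c b * K.ds a) := by
  unfold cotton12
  simp only [c4_weyl12, tr_add, tr_sub, tr_mul_left, div_Rm]
  have e1 : ∀ c, (K.tr fun n d => K.c2 K.ric n c d) = K.tr fun n d => K.c2 K.ric n d c := by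
    intro c; congr 1; funext n d; rw [c2_ric_symm]
  have e2 : ∀ a c, (K.tr fun n d => 2 * K.ds n * (K.g a b * K.g c d - K.g a d * K.g c b))
      = 2 * (K.g a b * K.ds c - K.ds a * K.g c b) := by
    intro a c
    rw [← K.tr_g_right K.ds c, ← K.tr_g_right K.ds a, ← tr_mul_left, ← tr_mul_right, ← tr_sub,
      ← tr_mul_left]
    congr 1; funext n d; ring
  rw [e1, e1, e2, K.tr_g_right (fun n => K.c2 K.ric n c b), K.tr_g_right (fun n => K.c2 K.ric n a b)]
  linear_combination 3 * K.g c b * K.two_div_ric a - 3 * K.g a b * K.two_div_ric c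

/-- The rough Laplacian of the Ricci tensor. -/
def lapRic (a b : Fin 4) : A := K.tr fun m c => K.c3 (K.c2 K.ric) m c a b

/-- The Laplacian of the scalar curvature. -/
def lap : A := K.tr K.hess

theorem c3_cotton12 (m a c b : Fin 4) : K.c3 K.cotton12 m a c b =
    6 * (K.c3 (K.c2 K.ric) m c a b - K.c3 (K.c2 K.ric) m a c b)
      - (K.g a b * K.hess m c - K.g c b * K.hess m a) := by
  have h : K.cotton12 = fun a c b => 6 * (K.c2 K.ric c a b - K.c2 K.ric a c b)
      - (K.g a b * K.ds c - K.g c b * K.ds a) := by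
    funext a c b; exact K.cotton12_eq a c b
  rw [h]
  simp only [c3, hess, c1, map_sub, Derivation.leibniz, smul_eq_mul, D_g,
    Fin.sum_univ_four, D_six]
  ring

/-- As `g` is parallel, the divergence passes to ∇r and ds, leaving two second-order contractions of
Ricci, the Laplacian and the Hessian of the scalar curvature. -/
theorem div_cotton12 (a b : Fin 4) : (K.tr fun m c => K.c3 K.cotton12 m a c b) =
    6 * (K.lapRic a b - K.divGradRic a b) - (K.g a b * K.lap - K.hess b a) := by
  simp only [c3_cotton12, tr_sub, tr_mul_left]
  have e : (K.tr fun m c => K.g c b * K.hess m a) = K.hess b a := by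
    rw [← K.tr_g_right (fun m => K.hess m a) b]
    congr 1; funext m c; rw [K.g_symm]
  rw [e]; rfl

/-- `∇^c ∇^d W_{acbd}` in terms of the divergence. -/
theorem tr_c5_weyl12 (a b : Fin 4) :
    (K.tr fun m c => K.tr fun n d => K.c5 (K.c4 K.weyl12) m n a c b d)
      = K.tr fun m c => K.c3 K.cotton12 m a c b := by
  congr 1; funext m c
  have h : (fun n d => K.c5 (K.c4 K.weyl12) m n a c b d) = fun n d =>
      K.c2 (fun n d => K.c4 K.weyl12 n a c b d) m n d - ∑ l, K.Γ l m a * K.c4 K.weyl12 n l c b d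
        - ∑ l, K.Γ l m c * K.c4 K.weyl12 n a l b d - ∑ l, K.Γ l m b * K.c4 K.weyl12 n a c l d := by
    funext n d; simp only [c5, c2]; ring
  rw [h]
  simp only [tr_sub, tr_sum, ← D_tr, tr_mul_left]
  rfl

/-- The contraction `12 W_{acbd} r^{cd}`. -/
theorem tr_weyl12_ric (a b : Fin 4) :
    (K.tr fun m c => K.tr fun n d => K.ric m n * K.weyl12 a c b d) =
    12 * K.RmRic a b - 6 * (K.g a b * K.tr K.ricSq - 2 * K.ricSq a b + K.sc * K.ric a b)
      + 2 * K.sc * (K.g a b * K.sc - K.ric a b) := by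
  have h : (fun m c => K.tr fun n d => K.ric m n * K.weyl12 a c b d) = fun m c =>
      12 * K.tr (fun n d => K.Rm c a d b * K.ric m n)
      - 6 * (K.g a b * K.tr (fun n d => K.ric m n * K.ric d c)
        - K.tr (fun n d => K.g a d * K.ric m n) * K.ric c b
        - K.tr (fun n d => K.ric m n * K.ric d a) * K.g b c
        + K.tr (fun n d => K.g c d * K.ric m n) * K.ric a b)
      + 2 * K.sc * (K.g a b * K.tr (fun n d => K.g c d * K.ric m n)
        - K.tr (fun n d => K.g a d * K.ric m n) * K.g b c) := by
    funext m c
    simp only [← tr_mul_left, ← tr_mul_right, ← tr_sub, ← tr_add]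
    congr 1; funext n d
    rw [weyl12, K.Rm_antisymm₁ c a, K.Rm_antisymm₂ c a, K.ric_symm d c, K.ric_symm d a,
      K.g_symm c b]
    ring
  rw [h]
  simp only [tr_add, tr_sub, tr_mul_left, K.tr_g_right (fun n => K.ric _ n), tr_mul_right]
  have e1 : (K.tr fun m c => K.tr fun n d => K.Rm c a d b * K.ric m n) = K.RmRic a b := by
    rw [← tr_swap]
    unfold RmRic
    congr 1; funext m c
    rw [← tr_swap]
  have e2 : (K.tr fun m c => K.tr fun n d => K.ric m n * K.ric d c) = K.tr K.ricSq := rfl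
  have e3 : (K.tr fun m c => K.ric m a * K.ric c b) = K.ricSq a b := by
    unfold ricSq; congr 1; funext m c; rw [K.ric_symm m a]
  have e4 : (K.tr fun m c => K.tr (fun n d => K.ric m n * K.ric d a) * K.g b c)
      = K.ricSq a b := by
    have := K.tr_g_right (fun m => K.tr fun n d => K.ric m n * K.ric d a) b
    simp only [mul_comm (K.g b _)] at this
    rw [this, ricSq, ← tr_swap]
    congr 1; funext m c
    rw [K.ric_symm b c, K.ric_symm m a, mul_comm]
  have e5 : (K.tr fun m c => K.ric m c * K.ric a b) = K.sc * K.ric a b := by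
    rw [tr_mul_right]; rfl
  have e6 : (K.tr fun m c => K.ric m c) = K.sc := rfl
  have e7 : (K.tr fun m c => K.ric m a * K.g b c) = K.ric a b := by
    have := K.tr_g_right (fun m => K.ric m a) b
    simp only [mul_comm (K.g b _)] at this
    rw [this, ric_symm]
  rw [e1, e2, e3, e4, e6, e7]
  ring

end Ricci
end MetricAlg

/-! ### Kähler structures and the calculus of composition with J. -/

/-- A Kähler structure over a commutative ring with four commuting derivations. -/
structure KahlerAlg (A : Type*) [CommRing A] [Algebra ℝ A] extends MetricAlg A where
  /-- the complex structure -/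
  J : Fin 4 → Fin 4 → A
  J_sq : ∀ a b, ∑ c, J a c * J c b = if a = b then -1 else 0
  J_g : ∀ a b, ∑ c, ∑ d, J c a * J d b * g c d = g a b
  closed : ∀ a b c, D a (∑ d, J d b * g d c) + D b (∑ d, J d c * g d a)
    + D c (∑ d, J d a * g d b) = 0
  nij : ∀ a b c, ∑ d, (J d b * D d (J a c) - J d c * D d (J a b)
    - J a d * (D b (J d c) - D c (J d b))) = 0

namespace KahlerAlg

open MetricAlg

variable {A : Type*} [CommRing A] [Algebra ℝ A] (K : KahlerAlg A)

/-- Composition of a 1-form with `J`. -/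
def jj (f : Fin 4 → A) (a : Fin 4) : A := ∑ c, K.J c a * f c

theorem jj_add (f h : Fin 4 → A) (a : Fin 4) :
    K.jj (fun c => f c + h c) a = K.jj f a + K.jj h a := by
  simp only [jj, mul_add, Finset.sum_add_distrib]

theorem jj_sub (f h : Fin 4 → A) (a : Fin 4) :
    K.jj (fun c => f c - h c) a = K.jj f a - K.jj h a := by
  simp only [jj, mul_sub, Finset.sum_sub_distrib]

theorem jj_neg (f : Fin 4 → A) (a : Fin 4) : K.jj (fun c => -f c) a = -K.jj f a := by
  simp only [jj, mul_neg, Finset.sum_neg_distrib]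

theorem jj_mul_left (x : A) (f : Fin 4 → A) (a : Fin 4) :
    K.jj (fun c => x * f c) a = x * K.jj f a := by
  simp only [jj, Finset.mul_sum]
  exact Finset.sum_congr rfl fun c _ => by ring

theorem jj_mul_right (x : A) (f : Fin 4 → A) (a : Fin 4) :
    K.jj (fun c => f c * x) a = K.jj f a * x := by
  simp only [mul_comm _ x, jj_mul_left]

theorem jj_zero (a : Fin 4) : K.jj (fun _ => 0) a = 0 := by simp [jj]

theorem jj_jj (f : Fin 4 → A) (a : Fin 4) : K.jj (K.jj f) a = -f a := by
  have h : K.jj (K.jj f) a = ∑ d, (∑ c, K.J d c * K.J c a) * f d := by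
    simp only [jj, Fin.sum_univ_four]; ring
  rw [h]
  simp [K.J_sq]

theorem jj_comm (T : Fin 4 → Fin 4 → A) (a b : Fin 4) :
    K.jj (fun c => K.jj (fun d => T c d) b) a = K.jj (fun d => K.jj (fun c => T c d) a) b := by
  simp only [jj, Fin.sum_univ_four]; ring

theorem jj_tr (T : Fin 4 → Fin 4 → Fin 4 → A) (a : Fin 4) :
    K.jj (fun c => K.tr (T c)) a = K.tr fun i k => K.jj (fun c => T c i k) a := by
  simp only [jj, tr, Fin.sum_univ_four]; ring

theorem jj_tr_tr (T : Fin 4 → Fin 4 → Fin 4 → Fin 4 → Fin 4 → A) (a : Fin 4) :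
    K.jj (fun c => K.tr fun m n => K.tr (T c m n)) a
      = K.tr fun m n => K.tr fun k l => K.jj (fun c => T c m n k l) a := by
  rw [K.jj_tr (fun c m n => K.tr (T c m n))]
  congr 1; funext m n
  rw [jj_tr]

/-- A tensor with `T(Ja, b) = -T(a, Jb)` is `J`-invariant. -/
theorem jj_jj_of_skew (T : Fin 4 → Fin 4 → A)
    (h : ∀ a b, K.jj (fun c => T c b) a = -K.jj (T a) b) (a b : Fin 4) :
    K.jj (fun c => K.jj (fun d => T c d) b) a = T a b := by
  have e : (fun c => K.jj (fun d => T c d) b) = fun c => -K.jj (fun e => T e b) c := by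
    funext c; rw [h]; ring
  rw [e, jj_neg]
  have := K.jj_jj (fun e => T e b) a
  rw [this, neg_neg]

/-- The fundamental form. -/
def om (a b : Fin 4) : A := K.jj (fun c => K.g c b) a

theorem om_antisymm (a b : Fin 4) : K.om a b = -K.om b a := by
  have h1 : ∀ a b, K.jj (fun c => K.jj (fun d => K.g c d) b) a = K.g a b := by
    intro a b
    rw [← K.J_g a b]
    simp only [jj, Fin.sum_univ_four]; ring
  have h2 : K.jj (fun b => K.jj (fun c => K.jj (fun d => K.g c d) b) a) b
      = K.jj (fun b => K.g a b) b := by simp only [h1]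
  have h3 : K.jj (fun b => K.jj (fun c => K.jj (fun d => K.g c d) b) a) b
      = K.jj (fun c => K.jj (K.jj (K.g c)) b) a := by
    rw [jj_comm]
  rw [h3] at h2
  simp only [jj_jj, jj_neg] at h2
  have h4 : K.om b a = K.jj (fun b => K.g a b) b := by
    unfold om; congr 1; funext c; rw [K.g_symm]
  rw [h4, ← h2, neg_neg]; rfl

theorem om_antisymm' (a b : Fin 4) :
    K.jj (fun c => K.g c b) a = -K.jj (K.g a) b := by
  have h := K.om_antisymm a b
  have h4 : K.om b a = K.jj (K.g a) b := by
    unfold om; congr 1; funext c; rw [K.g_symm]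
  rw [← h4, ← h]; rfl

/-- The bivector dual to the fundamental form. -/
def bivec (a b : Fin 4) : A := ∑ c, K.J a c * K.gi c b

/-- J is skew with respect to `g`, so g J is antisymmetric; multiplying by g⁻¹ on both sides
transports this to J g⁻¹. -/
theorem bivec_antisymm (a b : Fin 4) : K.bivec a b = -K.bivec b a := by
  let Jm : Matrix (Fin 4) (Fin 4) A := Matrix.of K.J
  let G : Matrix (Fin 4) (Fin 4) A := Matrix.of K.g
  let Gi : Matrix (Fin 4) (Fin 4) A := Matrix.of K.gi
  have hGi : G * Gi = 1 := by
    ext i j; simp only [G, Gi, Matrix.mul_apply, Matrix.of_apply, K.g_gi, Matrix.one_apply]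
  have hiG : Gi * G = 1 := mul_eq_one_comm.mp hGi
  have hsk : Jm.transpose * G = -(G * Jm) := by
    ext i j
    have := K.om_antisymm' i j
    simp only [Jm, G, Matrix.mul_apply, Matrix.transpose_apply, Matrix.of_apply, Matrix.neg_apply]
    rw [show ∑ x, K.J x i * K.g x j = K.jj (fun c => K.g c j) i from rfl, this]
    simp only [jj, mul_comm]
  have h : Gi * Jm.transpose = -(Jm * Gi) := by
    calc Gi * Jm.transpose = Gi * (Jm.transpose * G) * Gi := by
          rw [mul_assoc, mul_assoc, hGi, mul_one]
      _ = -(Jm * Gi) := by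
          rw [hsk, mul_neg, ← mul_assoc, hiG, one_mul, neg_mul]
  have h' := congrFun (congrFun h b) a
  simp only [Gi, Jm, Matrix.mul_apply, Matrix.transpose_apply, Matrix.of_apply,
    Matrix.neg_apply] at h'
  rw [bivec, bivec, ← h']
  exact Finset.sum_congr rfl fun c _ => by rw [K.gi_symm, mul_comm]

/-- Both traces are contractions of `T` with J g⁻¹, up to a transposition, so J moves across a
contraction with a change of sign. -/
theorem tr_jj (T : Fin 4 → Fin 4 → A) :
    K.tr (fun i k => K.jj (fun m => T m k) i) = -K.tr (fun i k => K.jj (T i) k) := by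
  have h1 : K.tr (fun i k => K.jj (fun m => T m k) i) = ∑ m, ∑ k, K.bivec m k * T m k := by
    simp only [tr, jj, bivec, Fin.sum_univ_four]; ring
  have h2 : K.tr (fun i k => K.jj (T i) k) = ∑ m, ∑ k, K.bivec k m * T m k := by
    simp only [tr, jj, bivec, Fin.sum_univ_four, K.gi_symm 1 0, K.gi_symm 2 0, K.gi_symm 3 0,
      K.gi_symm 2 1, K.gi_symm 3 1, K.gi_symm 3 2]
    ring
  rw [h1, h2, ← Finset.sum_neg_distrib]
  refine Finset.sum_congr rfl fun m _ => ?_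
  rw [← Finset.sum_neg_distrib]
  exact Finset.sum_congr rfl fun k _ => by rw [K.bivec_antisymm m k]; ring

theorem tr_jj_jj (T : Fin 4 → Fin 4 → A) :
    K.tr (fun i k => K.jj (fun m => K.jj (T m) k) i) = K.tr T := by
  rw [K.tr_jj (fun m k => K.jj (T m) k)]
  simp only [jj_jj, tr_neg, neg_neg]
  

/-! ### The complex structure is parallel -/

/-- The covariant derivative of `J`. -/
def cJ (i a b : Fin 4) : A :=
  K.D i (K.J a b) + ∑ m, K.Γ a i m * K.J m b - ∑ m, K.Γ m i b * K.J a m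

theorem c2_om (i a b : Fin 4) : K.c2 K.om i a b = ∑ c, K.cJ i c a * K.g c b := by
  simp only [c2, om, jj, cJ, Fin.sum_univ_four, map_add, Derivation.leibniz, smul_eq_mul, D_g]
  ring

theorem c2_antisymm (T : Fin 4 → Fin 4 → A) (hT : ∀ a b, T a b = -T b a) (i a b : Fin 4) :
    K.c2 T i a b = -K.c2 T i b a := by
  unfold c2
  rw [hT a b]
  simp only [fun m => hT m b, fun m => hT a m, map_neg, mul_neg, Finset.sum_neg_distrib]
  ring

theorem cyclic_c2_om (a b c : Fin 4) :
    K.c2 K.om a b c + K.c2 K.om b c a + K.c2 K.om c a b = 0 := by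
  have h := K.closed a b c
  have e : ∀ a b, ∑ d, K.J d a * K.g d b = K.om a b := fun _ _ => rfl
  simp only [e] at h
  simp only [c2, Fin.sum_univ_four]
  rw [K.Γ_symm 0 b a, K.Γ_symm 1 b a, K.Γ_symm 2 b a, K.Γ_symm 3 b a, K.Γ_symm 0 c b,
    K.Γ_symm 1 c b, K.Γ_symm 2 c b, K.Γ_symm 3 c b, K.Γ_symm 0 c a, K.Γ_symm 1 c a,
    K.Γ_symm 2 c a, K.Γ_symm 3 c a, K.om_antisymm 0 c, K.om_antisymm 1 c, K.om_antisymm 2 c,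
    K.om_antisymm 3 c, K.om_antisymm b 0, K.om_antisymm b 1, K.om_antisymm b 2,
    K.om_antisymm b 3, K.om_antisymm 0 a, K.om_antisymm 1 a, K.om_antisymm 2 a, K.om_antisymm 3 a]
  linear_combination h

/-- In the Nijenhuis tensor the partial derivatives may be replaced by covariant ones, since all
Christoffel terms cancel for a torsion-free connection. -/
theorem nij_cJ (a b c : Fin 4) : ∑ d, (K.J d b * K.cJ d a c - K.J d c * K.cJ d a b
    - K.J a d * (K.cJ b d c - K.cJ c d b)) = 0 := by
  rw [← K.nij a b c]
  simp only [cJ, Fin.sum_univ_four]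
  simp only [K.Γ_symm _ c b, K.Γ_symm _ 0 b, K.Γ_symm _ 1 b, K.Γ_symm _ 2 b, K.Γ_symm _ 3 b,
    K.Γ_symm _ 0 c, K.Γ_symm _ 1 c, K.Γ_symm _ 2 c, K.Γ_symm _ 3 c, K.Γ_symm _ 1 0,
    K.Γ_symm _ 2 0, K.Γ_symm _ 3 0, K.Γ_symm _ 2 1, K.Γ_symm _ 3 1, K.Γ_symm _ 3 2]
  ring

theorem nij_om (b c z : Fin 4) : K.jj (fun m => K.c2 K.om m c z) b
    - K.jj (fun m => K.c2 K.om m b z) c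
    + K.jj (fun m => K.c2 K.om b c m - K.c2 K.om c b m) z = 0 := by
  have h : ∑ a, (∑ d, (K.J d b * K.cJ d a c - K.J d c * K.cJ d a b
    - K.J a d * (K.cJ b d c - K.cJ c d b))) * K.g a z = 0 := by
    simp only [nij_cJ, zero_mul, Finset.sum_const_zero]
  have e : ∀ d, K.om d z = -K.om z d := fun d => K.om_antisymm d z
  have e2 : ∑ a, (∑ d, (K.J d b * K.cJ d a c - K.J d c * K.cJ d a b
    - K.J a d * (K.cJ b d c - K.cJ c d b))) * K.g a z =
    ∑ d, K.J d b * (∑ a, K.cJ d a c * K.g a z) - ∑ d, K.J d c * (∑ a, K.cJ d a b * K.g a z)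
      - ∑ d, (K.cJ b d c - K.cJ c d b) * K.om d z := by
    simp only [om, jj, Fin.sum_univ_four]; ring
  rw [e2] at h
  simp only [e] at h
  simp only [jj, c2_om]
  rw [← h]
  simp only [om, jj, Fin.sum_univ_four, K.g_symm 1 0, K.g_symm 2 0, K.g_symm 3 0,
    K.g_symm 2 1, K.g_symm 3 1, K.g_symm 3 2]
  ring

/-- Write A(x; y, z) for ∇ω with J applied to the derivative index x. The vanishing of the Nijenhuis
tensor, simplified by dω = 0, reads A(b; c, z) + A(c; z, b) - A(z; b, c) = 0. Adding a cyclic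
permutation of this leaves 2 A(c; z, b) = 0, and J is invertible. -/
theorem c2_om_zero (a b c : Fin 4) : K.c2 K.om a b c = 0 := by
  have anti := K.c2_antisymm K.om K.om_antisymm
  have F : ∀ b c z, K.jj (fun m => K.c2 K.om m c z) b + K.jj (fun m => K.c2 K.om m z b) c
      - K.jj (fun m => K.c2 K.om m b c) z = 0 := by
    intro b c z
    have h := K.nij_om b c z
    have e1 : (fun m => K.c2 K.om b c m - K.c2 K.om c b m) = fun m => -K.c2 K.om m b c := by
      funext m
      linear_combination K.cyclic_c2_om b c m - anti c b m
    have e2 : (fun m => K.c2 K.om m b z) = fun m => -K.c2 K.om m z b := by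
      funext m; exact anti m b z
    rw [e1, e2, jj_neg, jj_neg] at h
    linear_combination h
  have F0 : ∀ c z b, K.jj (fun m => K.c2 K.om m z b) c = 0 := by
    intro c z b
    apply cancel_two
    linear_combination F b c z + F c z b
  have := K.jj_jj (fun m => K.c2 K.om m b c) a
  have e : K.jj (fun m => K.c2 K.om m b c) = fun _ => 0 := by
    funext x; exact F0 x b c
  rw [e, jj_zero] at this
  exact neg_eq_zero.mp this.symm

theorem cJ_zero (i a b : Fin 4) : K.cJ i a b = 0 := by
  have h : ∀ d, ∑ c, K.g d c * K.cJ i c b = 0 := by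
    intro d
    rw [← K.c2_om_zero i b d, c2_om]
    exact Finset.sum_congr rfl fun c _ => by rw [K.g_symm, mul_comm]
  rw [← K.raise_lower (fun c => K.cJ i c b) a]
  simp [h]

/-- The counterpart of `D_g`: it removes derivatives of J from expansions, so that J commutes with
all the covariant derivatives below. -/
theorem D_J (i a b : Fin 4) :
    K.D i (K.J a b) = ∑ m, K.Γ m i b * K.J a m - ∑ m, K.Γ a i m * K.J m b := by
  have h := K.cJ_zero i a b
  unfold cJ at h
  linear_combination h

theorem c2_jj (T : Fin 4 → Fin 4 → A) (i a b : Fin 4) :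
    K.c2 (fun a b => K.jj (fun c => T c b) a) i a b = K.jj (fun c => K.c2 T i c b) a := by
  simp only [c2, jj, Fin.sum_univ_four, map_add, Derivation.leibniz, smul_eq_mul, D_J]
  ring

theorem c2_jj_right (T : Fin 4 → Fin 4 → A) (i a b : Fin 4) :
    K.c2 (fun a b => K.jj (T a) b) i a b = K.jj (fun c => K.c2 T i a c) b := by
  simp only [c2, jj, Fin.sum_univ_four, map_add, Derivation.leibniz, smul_eq_mul, D_J]
  ring

theorem c2_jj_jj (T : Fin 4 → Fin 4 → A) (i a b : Fin 4) :
    K.c2 (fun a b => K.jj (fun c => K.jj (T c) b) a) i a b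
      = K.jj (fun c => K.jj (K.c2 T i c) b) a := by
  rw [K.c2_jj (fun a b => K.jj (T a) b)]
  simp only [c2_jj_right]

theorem c3_jj₁ (T : Fin 4 → Fin 4 → Fin 4 → A) (i a b c : Fin 4) :
    K.c3 (fun a b c => K.jj (fun m => T m b c) a) i a b c
      = K.jj (fun m => K.c3 T i m b c) a := by
  simp only [c3, jj, Fin.sum_univ_four, map_add, Derivation.leibniz, smul_eq_mul, D_J]
  ring

theorem c3_jj₂ (T : Fin 4 → Fin 4 → Fin 4 → A) (i a b c : Fin 4) :
    K.c3 (fun a b c => K.jj (fun m => T a m c) b) i a b c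
      = K.jj (fun m => K.c3 T i a m c) b := by
  simp only [c3, jj, Fin.sum_univ_four, map_add, Derivation.leibniz, smul_eq_mul, D_J]
  ring

theorem c4_jj (T : Fin 4 → Fin 4 → Fin 4 → Fin 4 → A) (i a b c d : Fin 4) :
    K.c4 (fun a b c d => K.jj (fun m => T m b c d) a) i a b c d
      = K.jj (fun m => K.c4 T i m b c d) a := by
  simp only [c4, jj, Fin.sum_univ_four, map_add, Derivation.leibniz, smul_eq_mul, D_J]
  ring

theorem c2_tr (S : Fin 4 → Fin 4 → Fin 4 → Fin 4 → A) (e a b : Fin 4) :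
    K.c2 (fun a b => K.tr fun i k => S i k a b) e a b = K.tr fun i k => K.c4 S e i k a b := by
  have h : (fun i k => K.c4 S e i k a b) = fun i k => K.c2 (fun i k => S i k a b) e i k
      - ∑ m, K.Γ m e a * S i k m b - ∑ m, K.Γ m e b * S i k a m := by
    funext i k; simp only [c4, c2]
  rw [h, tr_sub, tr_sub, ← D_tr, tr_sum, tr_sum]
  simp only [tr_mul_left]
  rfl

/-! ### Curvature of a Kähler metric -/

/-- This is the Ricci identity applied to the parallel tensor ω: the curvature endomorphisms commute
with J. -/
theorem Rm_jj₂ (i j a b : Fin 4) :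
    K.jj (fun m => K.Rm i j m b) a = -K.jj (K.Rm i j a) b := by
  have h := K.ricci_identity_two K.om i j a b
  have h0 : K.c2 K.om = fun _ _ _ => 0 := by funext i a b; exact K.c2_om_zero i a b
  rw [h0, c3_zero, c3_zero] at h
  have e1 : ∑ l, K.Rup l a i j * K.om l b = -K.jj (fun m => K.Rm i j m a) b := by
    simp only [fun l => K.om_antisymm l b]
    simp only [om, jj, Rm, Fin.sum_univ_four, K.g_symm 1 0, K.g_symm 2 0, K.g_symm 3 0,
      K.g_symm 2 1, K.g_symm 3 1, K.g_symm 3 2]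
    ring
  have e2 : ∑ l, K.Rup l b i j * K.om a l = K.jj (fun m => K.Rm i j m b) a := by
    simp only [om, jj, Rm, Fin.sum_univ_four]
    ring
  have e3 : K.jj (fun m => K.Rm i j m a) b = -K.jj (K.Rm i j a) b := by
    rw [← jj_neg]; congr 1; funext m; exact K.Rm_antisymm₂ i j a m
  rw [e1, e2, e3] at h
  linear_combination h

theorem Rm_jj₁ (a b k l : Fin 4) :
    K.jj (fun m => K.Rm m b k l) a = -K.jj (fun m => K.Rm a m k l) b := by
  simp only [fun m => K.Rm_pair m b k l, fun m => K.Rm_pair a m k l]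
  exact K.Rm_jj₂ k l a b

/-- J is passed from the free index to the contracted one inside the curvature, across the
contraction by `tr_jj`, and out to the other free index. -/
theorem ric_jj (a b : Fin 4) : K.jj (fun m => K.ric m b) a = -K.jj (K.ric a) b := by
  unfold ric
  rw [jj_tr, K.jj_tr (fun c i k => K.Rm i a k c)]
  have h1 : (fun i k => K.jj (fun c => K.Rm i c k b) a) =
      fun i k => -K.jj (fun c => K.Rm c a k b) i := by
    funext i k; rw [Rm_jj₁, neg_neg]
  have h2 : (fun i k => K.jj (fun c => K.Rm i a k c) b) =
      fun i k => -K.jj (fun c => K.Rm i a c b) k := by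
    funext i k; rw [Rm_jj₂, neg_neg]
  rw [h1, h2, tr_neg, tr_neg, K.tr_jj (fun i k => K.Rm i a k b)]

theorem ric_jj_jj (a b : Fin 4) : K.jj (fun c => K.jj (K.ric c) b) a = K.ric a b :=
  K.jj_jj_of_skew K.ric K.ric_jj a b

/-- The Ricci form. -/
def rho (a b : Fin 4) : A := K.jj (fun c => K.ric c b) a

theorem rho_antisymm (a b : Fin 4) : K.rho a b = -K.rho b a := by
  unfold rho
  rw [ric_jj]
  congr 2; funext m; rw [K.ric_symm]

/-- The first Bianchi identity converts the trace defining Ricci into a trace over the first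
antisymmetric pair. In this form `a`, `b` are an index pair of the curvature, as needed for the
second Bianchi identity. -/
theorem two_rho (a b : Fin 4) :
    2 * K.rho a b = -K.tr fun i k => K.jj (fun m => K.Rm m k a b) i := by
  have h1 : K.rho a b = -K.tr fun i k => K.jj (fun m => K.Rm m a k b) i := by
    unfold rho ric
    rw [jj_tr, ← tr_neg]
    congr 1; funext i k; rw [Rm_jj₁, neg_neg]
  have h2 : (K.tr fun i k => K.jj (fun m => K.Rm k a m b) i) = K.rho a b := by
    have e := K.tr_jj (fun i k => K.Rm i a k b)
    rw [h1, e, neg_neg, ← tr_swap]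
  have h3 : (K.tr fun i k => K.jj (fun m => K.Rm m k a b) i) =
      K.tr fun i k => K.jj (fun m => K.Rm m a k b) i - K.jj (fun m => K.Rm k a m b) i := by
    congr 1; funext i k
    rw [← jj_sub]
    congr 1; funext m
    linear_combination K.Rm_bianchi_first m k a b - K.Rm_antisymm₁ m a k b
  rw [h3, tr_sub, h2]
  linear_combination h1

/-- By `two_rho` the Ricci form is a J-trace of the curvature over one index pair, and J and the
trace are parallel; closedness is then the second Bianchi identity in the other pair. -/
theorem cyclic_c2_rho (a b c : Fin 4) :
    K.c2 K.rho a b c + K.c2 K.rho b c a + K.c2 K.rho c a b = 0 := by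
  have h : ∀ e a b, 2 * K.c2 K.rho e a b
      = -K.tr fun i k => K.jj (fun m => K.c4 K.Rm e m k a b) i := by
    intro e a b
    have h1 : 2 * K.c2 K.rho e a b = K.c2 (fun a b => 2 * K.rho a b) e a b := by
      simp only [c2, two_mul, map_add, mul_add, Finset.sum_add_distrib]; ring
    have h2 : K.c2 (fun a b => 2 * K.rho a b) e a b
        = -K.c2 (fun a b => K.tr fun i k => K.jj (fun m => K.Rm m k a b) i) e a b := by
      simp only [two_rho]
      simp only [c2, map_neg, mul_neg, Finset.sum_neg_distrib]; ring
    rw [h1, h2, K.c2_tr (fun i k a b => K.jj (fun m => K.Rm m k a b) i)]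
    simp only [c4_jj]
  apply cancel_two
  rw [mul_add, mul_add, h, h, h, mul_zero, ← tr_neg, ← tr_neg, ← tr_neg, ← tr_add, ← tr_add,
    ← K.tr_zero]
  congr 1; funext i k
  rw [← jj_neg, ← jj_neg, ← jj_neg, ← jj_add, ← jj_add, ← K.jj_zero i]
  congr 1; funext m
  have p := K.c4_Rm_pair
  linear_combination -K.Rm_bianchi_second a b c m k - p a m k b c - p b m k c a - p c m k a b

theorem c2_rho (i a b : Fin 4) : K.c2 K.rho i a b = K.jj (fun c => K.c2 K.ric i c b) a :=
  K.c2_jj K.ric i a b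

/-- Closedness of ρ rewritten for Ricci, by applying J once more to the middle index. It replaces
the missing symmetry of ∇r in all three indices. -/
theorem c2_ric_exchange (a b c : Fin 4) : K.c2 K.ric a b c = K.c2 K.ric c b a
    + K.jj (fun f => K.jj (fun e => K.c2 K.ric f e a) c) b := by
  have h : K.jj (fun f => K.c2 K.rho a f c + K.c2 K.rho f c a + K.c2 K.rho c a f) b = 0 := by
    simp only [cyclic_c2_rho, jj_zero]
  rw [jj_add, jj_add] at h
  have e1 : K.jj (fun f => K.c2 K.rho a f c) b = -K.c2 K.ric a b c := by
    simp only [c2_rho]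
    exact K.jj_jj (fun c_1 => K.c2 K.ric a c_1 c) b
  have e2 : K.jj (fun f => K.c2 K.rho c a f) b = K.c2 K.ric c b a := by
    simp only [fun f => K.c2_antisymm K.rho K.rho_antisymm c a f, jj_neg, c2_rho]
    rw [K.jj_jj (fun e => K.c2 K.ric c e a) b, neg_neg]
  rw [e1, e2] at h
  simp only [c2_rho] at h
  linear_combination -h

theorem ricSq_jj_jj (a b : Fin 4) : K.jj (fun c => K.jj (K.ricSq c) b) a = K.ricSq a b := by
  have h : K.jj (fun c => K.jj (K.ricSq c) b) a =
      K.tr fun k l => K.jj (fun c => K.ric c k) a * K.jj (K.ric l) b := by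
    unfold ricSq
    have e1 : ∀ c, K.jj (fun d => K.tr fun k l => K.ric c k * K.ric l d) b
        = K.tr fun k l => K.ric c k * K.jj (K.ric l) b := by
      intro c; rw [K.jj_tr (fun d k l => K.ric c k * K.ric l d)]
      simp only [jj_mul_left]
    simp only [e1]
    rw [jj_tr]
    simp only [jj_mul_right]
  have h2 : (fun k l => K.jj (fun c => K.ric c k) a * K.jj (K.ric l) b) = fun k l =>
      K.jj (fun m => K.jj (fun n => K.ric a m * K.ric n b) l) k := by
    funext k l
    have e1 := K.ric_jj a k
    have e2 := K.ric_jj l b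
    simp only [jj_mul_left, jj_mul_right]
    linear_combination K.jj (K.ric l) b * e1 - K.jj (K.ric a) k * e2
  rw [h, h2, K.tr_jj_jj (fun m n => K.ric a m * K.ric n b)]
  rfl

/-- The curvature symmetries carry the two J's from the free indices to the contracted ones. One is
moved across its contraction and through Ricci, after which the pair disappears by `tr_jj_jj`. -/
theorem RmRic_jj_jj (a b : Fin 4) : K.jj (fun c => K.jj (K.RmRic c) b) a = K.RmRic a b := by
  have h : K.jj (fun c => K.jj (K.RmRic c) b) a =
      K.tr fun m c => K.tr fun k l =>
        K.jj (fun a => K.jj (fun b => K.Rm m a k b) b) a * K.ric c l := by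
    unfold RmRic
    simp only [fun c => K.jj_tr_tr (fun d m n k l => K.Rm m c k d * K.ric n l) b, jj_mul_right]
    rw [K.jj_tr_tr (fun c m n k l => K.jj (K.Rm m c k) b * K.ric n l)]
    simp only [jj_mul_right]
  have h2 : ∀ m k, K.jj (fun a => K.jj (fun b => K.Rm m a k b) b) a
      = K.jj (fun m => K.jj (fun k => K.Rm m a k b) k) m := by
    intro m k
    have e1 : (fun a => K.jj (fun b => K.Rm m a k b) b)
        = fun a => -K.jj (fun n => K.Rm m a n b) k := by
      funext a; rw [Rm_jj₂, neg_neg]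
    rw [e1, jj_neg, jj_comm]
    have e2 : (fun d => K.jj (fun c => K.Rm m c d b) a)
        = fun d => -K.jj (fun c => K.Rm c a d b) m := by
      funext d; rw [Rm_jj₁, neg_neg]
    rw [e2, jj_neg, neg_neg, jj_comm]
  rw [h]
  simp only [h2]
  have h4 : ∀ m c, (K.tr fun k l => K.jj (fun m => K.jj (fun k => K.Rm m a k b) k) m * K.ric c l)
      = K.jj (fun m => K.tr fun k l => K.Rm m a k b * K.jj (fun c => K.ric c l) c) m := by
    intro m c
    rw [jj_tr]
    simp only [jj_mul_right]
    have e := K.tr_jj (fun k l => K.jj (fun m => K.Rm m a k b) m * K.ric c l)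
    have e1 : (fun k l => K.jj (fun m => K.jj (fun k => K.Rm m a k b) k) m * K.ric c l) =
        fun k l => K.jj (fun k => K.jj (fun m => K.Rm m a k b) m * K.ric c l) k := by
      funext k l; rw [jj_mul_right, jj_comm]
    rw [e1, e, ← tr_neg]
    congr 1; funext k l
    rw [jj_mul_left, ric_jj]; ring
  simp only [h4]
  have h5 := K.tr_jj_jj (fun m c => K.tr fun k l => K.Rm m a k b * K.ric c l)
  rw [RmRic, ← h5]
  congr 1; funext m c; congr 1; funext m
  rw [jj_tr]
  simp only [jj_mul_left]

/-- Bochner-type formula for the Ricci tensor of a Kähler metric. -/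
theorem lapRic_eq (b c : Fin 4) :
    K.lapRic b c = K.divGradRic c b + K.jj (fun f => K.jj (K.divGradRic f) c) b := by
  have h : K.c2 K.ric = fun a b c => K.c2 K.ric c b a
      + K.jj (fun f => K.jj (fun e => K.c2 K.ric f e a) c) b := by
    funext a b c; exact K.c2_ric_exchange a b c
  -- The covariant derivative of the exchange identity; it passes through J because J is parallel.
  have h1 : ∀ m a b c, K.c3 (K.c2 K.ric) m a b c = K.c3 (K.c2 K.ric) m c a b
      + K.jj (fun f => K.jj (fun e => K.c3 (K.c2 K.ric) m f a e) c) b := by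
    intro m a b c
    have s := K.c3_symm (K.c2 K.ric) K.c2_ric_symm
    have e1 : K.c3 (K.c2 K.ric) m a b c = K.c3 (K.c2 K.ric) m c b a
        + K.jj (fun f => K.jj (fun e => K.c3 (K.c2 K.ric) m f e a) c) b := by
      have e2 : K.c3 (K.c2 K.ric) m a b c = K.c3 (fun a b c => K.c2 K.ric c b a
          + K.jj (fun f => K.jj (fun e => K.c2 K.ric f e a) c) b) m a b c := by rw [← h]
      rw [e2]
      have e3 := K.c3_jj₁ (fun f c a => K.jj (fun e => K.c2 K.ric f e a) c) m b c a
      simp only [K.c3_jj₂ (K.c2 K.ric)] at e3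
      rw [← e3]
      simp only [c3, map_add, mul_add, Finset.sum_add_distrib]
      ring
    rw [e1, s m c b a]
    simp only [s m _ a _]
  unfold lapRic divGradRic
  rw [show (K.tr fun m a => K.c3 (K.c2 K.ric) m a b c) = K.tr fun m a =>
    K.c3 (K.c2 K.ric) m c a b
      + K.jj (fun f => K.jj (fun e => K.c3 (K.c2 K.ric) m f a e) c) b by simp only [← h1], tr_add]
  have e : ∀ f, K.jj (fun e => K.tr fun m c => K.c3 (K.c2 K.ric) m f c e) c =
      K.tr fun m a => K.jj (fun e => K.c3 (K.c2 K.ric) m f a e) c := by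
    intro f; rw [K.jj_tr (fun e m c => K.c3 (K.c2 K.ric) m f c e)]
  simp only [e]
  rw [K.jj_tr (fun f m a => K.jj (fun e => K.c3 (K.c2 K.ric) m f a e) c)]

end KahlerAlg

/-! ### Products of antisymmetric 4 × 4 matrices. -/

section Antisymm

variable {A : Type*} [CommRing A] [Algebra ℝ A]

theorem diag_zero_of_antisymm {P : Fin 4 → Fin 4 → A} (hP : ∀ a b, P a b = -P b a) (a : Fin 4) :
    P a a = 0 :=
  MetricAlg.cancel_two (by linear_combination hP a a)

set_option maxHeartbeats 1000000 in
/-- The product `N` of two antisymmetric `4 × 4` matrices satisfies a quadratic equation. -/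
theorem antisymm_mul_antisymm_quadratic {P W : Fin 4 → Fin 4 → A} (hP : ∀ a b, P a b = -P b a)
    (hW : ∀ a b, W a b = -W b a) (N : Fin 4 → Fin 4 → A)
    (hN : ∀ a b, N a b = ∑ c, P a c * W c b) (a b : Fin 4) :
    8 * ∑ c, N a c * N c b - 4 * (∑ c, N c c) * N a b =
      (if a = b then 1 else 0) * (2 * ∑ c, ∑ d, N c d * N d c - (∑ c, N c c) ^ 2) := by
  simp only [hN, Fin.sum_univ_four, diag_zero_of_antisymm hP, diag_zero_of_antisymm hW,
    hP 1 0, hP 2 0, hP 3 0, hP 2 1, hP 3 1, hP 3 2, hW 1 0, hW 2 0, hW 3 0, hW 2 1, hW 3 1, hW 3 2]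
  fin_cases a <;> fin_cases b <;>
    simp [diag_zero_of_antisymm hP, diag_zero_of_antisymm hW,
      hP 1 0, hP 2 0, hP 3 0, hP 2 1, hP 3 1, hP 3 2, hW 1 0, hW 2 0, hW 3 0, hW 2 1, hW 3 1,
      hW 3 2] <;> ring

end Antisymm

/-! ### The Bach tensor of an extremal Kähler metric. -/

namespace KahlerAlg

open MetricAlg

variable {A : Type*} [CommRing A] [Algebra ℝ A] (K : KahlerAlg A)

/-- The Cayley–Hamilton theorem for the (complex linear) Ricci endomorphism. -/
theorem ricSq_eq (a b : Fin 4) : 8 * K.ricSq a b - 4 * K.sc * K.ric a b =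
    K.g a b * (2 * K.tr K.ricSq - K.sc ^ 2) := by
  let N : Fin 4 → Fin 4 → A := fun a b => ∑ c, K.ric a c * K.gi c b
  -- The Ricci endomorphism is a product of two antisymmetric matrices, ρ and J g⁻¹, the two J's
  -- cancelling. Such a product satisfies an equation of degree 2 instead of 4.
  have hN : ∀ a b, N a b = ∑ c, K.rho a c * K.bivec c b := by
    intro a b
    have e : ∀ c, K.rho a c = -K.jj (K.ric a) c := fun c => K.ric_jj a c
    have e1 : ∑ c, K.rho a c * K.bivec c b = -∑ d, K.jj (K.jj (K.ric a)) d * K.gi d b := by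
      simp only [e, bivec]
      simp only [jj, Fin.sum_univ_four]; ring
    rw [e1]
    simp only [jj_jj, N, neg_mul, Finset.sum_neg_distrib, neg_neg]
  have key := antisymm_mul_antisymm_quadratic K.rho_antisymm K.bivec_antisymm N hN
  have t : ∑ c, N c c = K.sc := by
    simp only [N, sc, tr]
    rw [Finset.sum_comm]
    exact Finset.sum_congr rfl fun i _ => Finset.sum_congr rfl fun j _ => by
      rw [K.ric_symm i j]; ring
  have hg : ∀ a b, ∑ c, N a c * K.g c b = K.ric a b := by
    intro a b
    have h := K.lower_raise (K.ric a) b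
    rw [← h]
    simp only [N, Fin.sum_univ_four]
    simp only [K.gi_symm 1 0, K.gi_symm 2 0, K.gi_symm 3 0, K.gi_symm 2 1, K.gi_symm 3 1,
      K.gi_symm 3 2, fun c => K.g_symm c b]
    ring
  have hNN : ∀ a b, ∑ d, (∑ c, N a c * N c d) * K.g d b = K.ricSq a b := by
    intro a b
    have : ∑ d, (∑ c, N a c * N c d) * K.g d b = ∑ c, N a c * ∑ d, N c d * K.g d b := by
      simp only [Fin.sum_univ_four]; ring
    rw [this]
    simp only [hg]
    simp only [N, ricSq, tr, Fin.sum_univ_four]; ring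
  have t2 : ∑ c, ∑ d, N c d * N d c = K.tr K.ricSq := by
    simp only [N, ricSq, tr, Fin.sum_univ_four]
    simp only [K.gi_symm 1 0, K.gi_symm 2 0, K.gi_symm 3 0, K.gi_symm 2 1, K.gi_symm 3 1,
      K.gi_symm 3 2, K.ric_symm 1 0, K.ric_symm 2 0, K.ric_symm 3 0, K.ric_symm 2 1,
      K.ric_symm 3 1, K.ric_symm 3 2]
    ring
  rw [t, t2] at key
  have h1 : ∑ d, (8 * ∑ c, N a c * N c d - 4 * K.sc * N a d) * K.g d b
      = 8 * K.ricSq a b - 4 * K.sc * K.ric a b := by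
    rw [← hNN, ← hg a b, Finset.mul_sum, Finset.mul_sum, ← Finset.sum_sub_distrib]
    exact Finset.sum_congr rfl fun d _ => by ring
  rw [← h1]
  have h2 : ∀ d, (8 * ∑ c, N a c * N c d - 4 * K.sc * N a d) * K.g d b
      = if a = d then (2 * K.tr K.ricSq - K.sc ^ 2) * K.g d b else 0 := by
    intro d; rw [key]; split_ifs <;> ring
  simp only [h2, Finset.sum_ite_eq, Finset.mem_univ, if_true]
  ring

/-- The gradient of the scalar curvature. -/
def xi (a : Fin 4) : A := ∑ b, K.gi a b * K.ds b

/-- The gradient of the scalar curvature preserves `J`. -/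
def IsExtremal : Prop := ∀ a b, ∑ c, (K.xi c * K.D c (K.J a b) - K.J c b * K.D c (K.xi a)
    + K.J a c * K.D b (K.xi c)) = 0

/-- The covariant derivative of the gradient. -/
def cxi (i a : Fin 4) : A := K.D i (K.xi a) + ∑ m, K.Γ a i m * K.xi m

theorem lower_cxi (i d : Fin 4) : ∑ a, K.cxi i a * K.g a d = K.hess i d := by
  have h : ∀ d, ∑ a, K.xi a * K.g a d = K.ds d := by
    intro d
    have h := K.lower_raise K.ds d
    rw [← h]
    exact Finset.sum_congr rfl fun a _ => by rw [K.g_symm, mul_comm]; rfl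
  unfold hess c1
  rw [← h d]
  simp only [← h]
  simp only [cxi, map_add, Derivation.leibniz, smul_eq_mul, D_g, Fin.sum_univ_four]
  ring

/-- As J is parallel and the connection torsion-free, the Lie derivative of J along grad s is the
commutator of J with ∇ grad s. Lowering an index turns ∇ grad s into Hess s. -/
theorem hess_jj (hK : K.IsExtremal) (b d : Fin 4) :
    K.jj (fun c => K.hess c d) b = -K.jj (K.hess b) d := by
  have h : ∀ a, ∑ c, (K.J a c * K.cxi b c - K.J c b * K.cxi c a) = 0 := by
    intro a
    rw [← hK a b]
    simp only [cxi, D_J, Fin.sum_univ_four]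
    simp only [K.Γ_symm _ 0 b, K.Γ_symm _ 1 b, K.Γ_symm _ 2 b, K.Γ_symm _ 3 b, K.Γ_symm _ 1 0,
      K.Γ_symm _ 2 0, K.Γ_symm _ 3 0, K.Γ_symm _ 2 1, K.Γ_symm _ 3 1, K.Γ_symm _ 3 2]
    ring
  have h1 : ∑ a, (∑ c, (K.J a c * K.cxi b c - K.J c b * K.cxi c a)) * K.g a d = 0 := by
    simp only [h, zero_mul, Finset.sum_const_zero]
  have h2 : ∑ a, (∑ c, (K.J a c * K.cxi b c - K.J c b * K.cxi c a)) * K.g a d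
      = ∑ c, K.cxi b c * K.om c d - K.jj (fun c => ∑ a, K.cxi c a * K.g a d) b := by
    simp only [om, jj, Fin.sum_univ_four]; ring
  have h3 : ∑ c, K.cxi b c * K.om c d = -K.jj (fun e => ∑ c, K.cxi b c * K.g c e) d := by
    simp only [fun c => K.om_antisymm c d]
    simp only [om, jj, Fin.sum_univ_four]
    simp only [K.g_symm 1 0, K.g_symm 2 0, K.g_symm 3 0, K.g_symm 2 1, K.g_symm 3 1,
      K.g_symm 3 2]
    ring
  rw [h2, h3] at h1
  simp only [lower_cxi] at h1
  linear_combination -h1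

theorem hess_jj_jj (hK : K.IsExtremal) (a b : Fin 4) :
    K.jj (fun c => K.jj (K.hess c) b) a = K.hess a b :=
  K.jj_jj_of_skew K.hess (K.hess_jj hK) a b

/-- All three terms of `two_divGradRic` are J-invariant; extremality is needed only for the Hessian.
-/
theorem divGradRic_jj_jj (hK : K.IsExtremal) (a b : Fin 4) :
    K.jj (fun c => K.jj (K.divGradRic c) b) a = K.divGradRic a b := by
  apply cancel_two
  rw [two_divGradRic, ← K.hess_jj_jj hK, ← K.ricSq_jj_jj, ← K.RmRic_jj_jj, ← jj_mul_left,
    ← jj_mul_left, ← jj_mul_left, ← jj_add, ← jj_sub]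
  congr 1; funext c
  rw [← jj_mul_left, ← jj_mul_left, ← jj_mul_left, ← jj_add, ← jj_sub]
  congr 1; funext d
  exact K.two_divGradRic c d

theorem divGradRic_symm (a b : Fin 4) : K.divGradRic a b = K.divGradRic b a := by
  apply cancel_two
  have h1 : K.ricSq a b = K.ricSq b a := by
    unfold ricSq; rw [← tr_swap]; congr 1; funext i j
    rw [K.ric_symm a j, K.ric_symm i b, mul_comm]
  have h2 : K.RmRic a b = K.RmRic b a := by
    unfold RmRic; rw [tr_tr]; congr 1; funext i j; congr 1; funext k l
    rw [K.Rm_pair k a, K.ric_symm]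
  rw [two_divGradRic, two_divGradRic, K.hess_symm, h1, h2]

/-- Twenty-four times the Bach tensor of an extremal Kähler metric. -/
def bach24 (a b : Fin 4) : A :=
  8 * K.hess a b + 4 * K.sc * K.ric a b - (K.sc ^ 2 + 2 * K.lap) * K.g a b

/-- By J-invariance and symmetry of ∇^c∇_a r_{cb}, `lapRic_eq` makes the rough Laplacian of Ricci
twice that tensor. The multiple 6 of `two_divGradRic` then produces -12 R·r, which cancels the +12
R·r in W·r, and the multiple 3 of `ricSq_eq` absorbs r² together with its trace. -/
theorem bach_formula (hK : K.IsExtremal) (a b : Fin 4) :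
    2 * (K.tr fun m c => K.tr fun n d => K.c5 (K.c4 K.weyl12) m n a c b d)
      + (K.tr fun m c => K.tr fun n d => K.ric m n * K.weyl12 a c b d) = K.bach24 a b := by
  rw [tr_c5_weyl12, div_cotton12, tr_weyl12_ric, lapRic_eq, K.divGradRic_jj_jj hK,
    K.divGradRic_symm b a, K.hess_symm b a, bach24]
  linear_combination 6 * K.two_divGradRic a b + 3 * K.ricSq_eq a b

theorem bach24_symm (a b : Fin 4) : K.bach24 a b = K.bach24 b a := by
  rw [bach24, bach24, K.hess_symm, K.ric_symm, K.g_symm]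

theorem bach24_jj (hK : K.IsExtremal) (a b : Fin 4) :
    K.jj (fun c => K.bach24 c b) a = -K.jj (K.bach24 a) b := by
  have e1 : (fun c => K.bach24 c b) = fun c =>
    8 * K.hess c b + 4 * K.sc * K.ric c b - (K.sc ^ 2 + 2 * K.lap) * K.g c b := rfl
  have e2 : K.bach24 a = fun c =>
    8 * K.hess a c + 4 * K.sc * K.ric a c - (K.sc ^ 2 + 2 * K.lap) * K.g a c := rfl
  rw [e1, e2, jj_sub, jj_sub, jj_add, jj_add]
  simp only [jj_mul_left]
  have h3 : K.jj (fun c => K.g c b) a = -K.jj (K.g a) b := K.om_antisymm' a b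
  have h2 : K.jj (fun m => K.ric m b) a = -K.jj (K.ric a) b := K.ric_jj a b
  have h1 : K.jj (fun c => K.hess c b) a = -K.jj (K.hess a) b := K.hess_jj hK a b
  rw [h1, h2, h3]; ring

theorem tr_bach24 : K.tr K.bach24 = 0 := by
  have e : K.tr K.bach24 = K.tr fun a b => 8 * K.hess a b + 4 * K.sc * K.ric a b
    - (K.sc ^ 2 + 2 * K.lap) * K.g a b := rfl
  rw [e, tr_sub, tr_add, tr_mul_left, tr_mul_left, tr_mul_left]
  have h1 : K.tr (fun a b => K.hess a b) = K.lap := rfl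
  have h2 : K.tr (fun a b => K.ric a b) = K.sc := rfl
  have h3 : K.tr (fun a b => K.g a b) = 4 := K.tr_g
  rw [h1, h2, h3]; ring

/-! ### The divergence -/

/-- The Ricci endomorphism applied to the differential of the scalar curvature. -/
def ricDs (b : Fin 4) : A := K.tr fun l k => K.ric k b * K.ds l

theorem Rup_ds (b m a : Fin 4) :
    ∑ l, K.Rup l b m a * K.ds l = K.tr fun l k => K.Rm m a k b * K.ds l := by
  simp only [Rup_eq, tr, Finset.sum_mul]
  exact Finset.sum_congr rfl fun i _ => Finset.sum_congr rfl fun j _ => by ring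

/-- J-invariance of the Hessian rewrites its divergence as J applied to the trace `Z`. Moving J
across that contraction shows that 2 `Z` is the trace of a commutator of covariant derivatives of
ds; the curvature that appears is traced over a pair with J, hence is the Ricci form. -/
theorem div_hess (hK : K.IsExtremal) (b : Fin 4) :
    (K.tr fun m a => K.c2 K.hess m a b) = -K.ricDs b := by
  have inv : K.hess = fun a b => K.jj (fun c => K.jj (K.hess c) b) a := by
    funext a b; exact (K.hess_jj_jj hK a b).symm
  have h1 : ∀ m a b, K.c2 K.hess m a b = K.jj (fun d => K.jj (fun c => K.c2 K.hess m c d) a) b := by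
    intro m a b
    rw [← K.jj_comm (fun c d => K.c2 K.hess m c d), ← K.c2_jj_jj K.hess, ← inv]
  let Z : Fin 4 → A := fun d => K.tr fun m a => K.jj (fun c => K.c2 K.hess m c d) a
  have h2 : (K.tr fun m a => K.c2 K.hess m a b) = K.jj Z b := by
    rw [K.jj_tr (fun d m a => K.jj (fun c => K.c2 K.hess m c d) a)]
    congr 1; funext m a; exact h1 m a b
  have h3 : ∀ d, Z d = -(K.tr fun l k => K.rho k d * K.ds l) := by
    intro d
    have e1 : Z d = -K.tr fun m a => K.jj (fun c => K.c2 K.hess c m d) a := by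
      have := K.tr_jj (fun m a => K.c2 K.hess m a d)
      rw [← K.tr_swap (fun m a => K.jj (fun c => K.c2 K.hess c m d) a), this, neg_neg]
    have e2 : 2 * Z d = K.tr fun m a => -K.tr fun l k => K.jj (fun c => K.Rm m c k d) a * K.ds l := by
      have : 2 * Z d = K.tr fun m a => K.jj (fun c => K.c2 K.hess m c d) a
          - K.jj (fun c => K.c2 K.hess c m d) a := by
        rw [tr_sub]; linear_combination e1
      rw [this]
      congr 1; funext m a
      rw [← jj_sub]
      simp only [← jj_mul_right]
      rw [← K.jj_tr (fun c l k => K.Rm m c k d * K.ds l), ← jj_neg]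
      congr 1; funext c
      rw [← Rup_ds]
      exact K.ricci_identity_one K.ds m c d
    have e3 : ∀ k, (K.tr fun m a => K.jj (fun c => K.Rm m c k d) a) = 2 * K.rho k d := by
      intro k
      have := K.tr_jj (fun m a => K.Rm m a k d)
      rw [two_rho, this, neg_neg]
    apply cancel_two
    rw [e2, tr_neg, tr_tr]
    simp only [tr_mul_right, e3]
    rw [mul_neg, ← tr_mul_left]
    simp only [mul_assoc]
  rw [h2]
  have e4 : Z = fun d => -(K.tr fun l k => K.rho k d * K.ds l) := funext h3
  rw [e4, jj_neg, K.jj_tr (fun d l k => K.rho k d * K.ds l)]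
  unfold ricDs
  congr 2; funext l k
  rw [jj_mul_right]
  congr 1
  rw [← K.ric_jj_jj k b, jj_comm]
  rfl

/-- Commuting ∇_b past ∇_m in ∇_b∇^m∇_m s gives the divergence of the Hessian plus a Ricci term,
each equal to -r(grad s, ·). -/
theorem D_lap (hK : K.IsExtremal) (b : Fin 4) : K.D b K.lap = -2 * K.ricDs b := by
  have h : K.D b K.lap = K.tr fun m a => K.c2 K.hess m a b
      + K.tr fun l k => K.Rm m b k a * K.ds l := by
    rw [lap, D_tr]
    congr 1; funext m a
    have h1 := K.ricci_identity_one K.ds m b a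
    rw [Rup_ds] at h1
    have h2 := K.c2_symm K.hess K.hess_symm m a b
    rw [h2]
    have h3 : K.c2 (K.c1 K.ds) = K.c2 K.hess := rfl
    rw [h3] at h1
    linear_combination -h1
  rw [h, tr_add, K.div_hess hK, tr_tr]
  have h4 : (K.tr fun l k => K.tr fun m a => K.Rm m b k a * K.ds l) = -K.ricDs b := by
    unfold ricDs
    rw [← tr_neg]
    congr 1; funext l k
    rw [tr_mul_right, ← neg_mul, K.ric_symm k b]
    congr 1
    unfold ric
    rw [← tr_neg]
    congr 1; funext m a
    rw [K.Rm_antisymm₂]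
  rw [h4]; ring

/-- The terms in r(grad s, ·) have coefficients -8 from the Hessian, 4 from ds·r and 4 from the
Laplacian. The terms in s ds cancel by the contracted Bianchi identity. -/
theorem div_bach24 (hK : K.IsExtremal) (b : Fin 4) :
    (K.tr fun m a => K.c2 K.bach24 m a b) = 0 := by
  have h : ∀ m a, K.c2 K.bach24 m a b = 8 * K.c2 K.hess m a b + (4 * K.ds m * K.ric a b
      + 4 * K.sc * K.c2 K.ric m a b) - (2 * K.sc * K.ds m + 2 * K.D m K.lap) * K.g a b := by
    intro m a
    have h4 : K.D m 4 = 0 := by exact_mod_cast (K.D m).map_natCast 4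
    have h8 : K.D m 8 = 0 := by exact_mod_cast (K.D m).map_natCast 8
    simp only [c2, bach24, ds, map_sub, map_add, pow_two, Derivation.leibniz, smul_eq_mul, D_g,
      Fin.sum_univ_four, D_two, h4, h8]
    ring
  simp only [h, tr_sub, tr_add]
  have e1 : (K.tr fun m a => 4 * K.ds m * K.ric a b) = 4 * K.ricDs b := by
    rw [ricDs, ← tr_mul_left]; congr 1; funext m a; ring
  have e2 : (K.tr fun m a => (2 * K.sc * K.ds m + 2 * K.D m K.lap) * K.g a b)
      = 2 * K.sc * K.ds b + 2 * K.D b K.lap := by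
    rw [← K.tr_g_right (fun m => 2 * K.sc * K.ds m + 2 * K.D m K.lap) b]
    congr 1; funext m a; rw [K.g_symm]; ring
  rw [e1, e2, tr_mul_left, tr_mul_left, K.div_hess hK, K.D_lap hK]
  linear_combination 2 * K.sc * K.two_div_ric b

end KahlerAlg

open TopologicalSpace

/-! ### The ring of smooth functions on an open set -/

/-- Extension by zero. -/
def extZero (U : Opens E4) (f : U → ℝ) : E4 → ℝ := Function.extend Subtype.val f 0

theorem extZero_coe {U : Opens E4} (f : U → ℝ) (y : U) : extZero U f y = f y :=
  Subtype.val_injective.extend_apply f 0 y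

theorem contDiffOn_extZero_iff {U : Opens E4} {f : U → ℝ} {F : E4 → ℝ} (h : ∀ y : U, F y = f y) :
    ContDiffOn ℝ ∞ (extZero U f) U ↔ ContDiffOn ℝ ∞ F U :=
  contDiffOn_congr fun y hy => by rw [h ⟨y, hy⟩]; exact extZero_coe f ⟨y, hy⟩

/-- The algebra of smooth functions on an open subset of the model space. -/
def SmoothFn (U : Opens E4) : Subalgebra ℝ (U → ℝ) where
  carrier := {f | ContDiffOn ℝ ∞ (extZero U f) U}
  mul_mem' {a b} ha hb := (contDiffOn_extZero_iff (F := fun y => extZero U a y * extZero U b y)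
    fun y => by simp only [extZero_coe, Pi.mul_apply]).mpr (ContDiffOn.mul ha hb)
  add_mem' {a b} ha hb := (contDiffOn_extZero_iff (F := fun y => extZero U a y + extZero U b y)
    fun y => by simp only [extZero_coe, Pi.add_apply]).mpr (ContDiffOn.add ha hb)
  algebraMap_mem' r := (contDiffOn_extZero_iff (F := fun _ => r) fun _ => rfl).mpr contDiffOn_const

namespace SmoothFn

variable {U : Opens E4}

/-- The function on the model space that vanishes outside `U`. -/
def ext (a : SmoothFn U) : E4 → ℝ := extZero U a

/-- Evaluation at a point. -/
def ev (y : U) : SmoothFn U →ₐ[ℝ] ℝ := (Pi.evalAlgHom ℝ (fun _ : U => ℝ) y).comp (SmoothFn U).val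

theorem ext_apply (a : SmoothFn U) (y : U) : ext a y = ev y a := extZero_coe _ y

theorem contDiffOn_ext (a : SmoothFn U) : ContDiffOn ℝ ∞ (ext a) U := a.2

theorem contDiffAt_ext (a : SmoothFn U) (y : U) : ContDiffAt ℝ ∞ (ext a) y :=
  (contDiffOn_ext a).contDiffAt (U.isOpen.mem_nhds y.2)

theorem differentiableAt_ext (a : SmoothFn U) (y : U) : DifferentiableAt ℝ (ext a) y :=
  (contDiffAt_ext a y).differentiableAt (by simp)

theorem ext_ev {a b : SmoothFn U} (h : ∀ y, ev y a = ev y b) : a = b :=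
  Subtype.ext (funext h)

/-- The restriction of a function which is smooth on `U`. -/
def restrict (f : E4 → ℝ) (hf : ContDiffOn ℝ ∞ f U) : SmoothFn U :=
  ⟨fun y => f y, (contDiffOn_extZero_iff fun _ => rfl).mpr hf⟩

@[simp] theorem ev_restrict (f : E4 → ℝ) (hf : ContDiffOn ℝ ∞ f U) (y : U) : ev y (restrict f hf) = f y := rfl

theorem eventuallyEq_ext {f : E4 → ℝ} {a : SmoothFn U} (h : ∀ z : U, f z = ev z a) (y : U) :
    f =ᶠ[nhds (y : E4)] ext a := by
  filter_upwards [U.isOpen.mem_nhds y.2] with z hz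
  rw [h ⟨z, hz⟩]; exact (ext_apply a ⟨z, hz⟩).symm

theorem contDiffOn_of_eq {f : E4 → ℝ} {a : SmoothFn U} (h : ∀ z : U, f z = ev z a) :
    ContDiffOn ℝ ∞ f U :=
  (contDiffOn_ext a).congr fun z hz => by rw [h ⟨z, hz⟩]; exact (ext_apply a ⟨z, hz⟩).symm

/-- Partial derivatives at points of `U` ignore the values off `U`, because `U` is open. Hence any
function given on the whole model space may be compared with the extension by zero of a ring
element. -/
theorem pd_congr {f : E4 → ℝ} {a : SmoothFn U} (h : ∀ z : U, f z = ev z a) (i : Fin 4) (y : U) :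
    Coord.pd i f y = Coord.pd i (ext a) y := by
  unfold Coord.pd
  rw [(eventuallyEq_ext h y).fderiv_eq]

theorem contDiffOn_pd (a : SmoothFn U) (i : Fin 4) :
    ContDiffOn ℝ ∞ (Coord.pd i (ext a)) U :=
  ((contDiffOn_ext a).fderiv_of_isOpen U.isOpen (m := ∞) (by simp)).clm_apply contDiffOn_const

/-- The partial derivatives. -/
def D (i : Fin 4) : Derivation ℝ (SmoothFn U) (SmoothFn U) :=
  Derivation.mk'
    { toFun := fun a => restrict (Coord.pd i (ext a)) (contDiffOn_pd a i)
      map_add' := fun a b => ext_ev fun y => by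
        rw [map_add, ev_restrict, ev_restrict, ev_restrict, ← pd_congr (f := fun z => ext a z + ext b z) (fun z => by
          rw [map_add, ext_apply, ext_apply])]
        unfold Coord.pd
        rw [fderiv_fun_add (differentiableAt_ext a y) (differentiableAt_ext b y)]
        rfl
      map_smul' := fun r a => ext_ev fun y => by
        rw [RingHom.id_apply, map_smul, ev_restrict, ev_restrict,
          ← pd_congr (f := fun z => r • ext a z) (fun z => by rw [map_smul, ext_apply])]
        unfold Coord.pd
        rw [fderiv_fun_const_smul (differentiableAt_ext a y)]
        rfl }
    fun a b => ext_ev fun y => by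
      change ev y (restrict (Coord.pd i (ext (a * b))) (contDiffOn_pd _ i)) =
        ev y (a • restrict (Coord.pd i (ext b)) (contDiffOn_pd _ i)
          + b • restrict (Coord.pd i (ext a)) (contDiffOn_pd _ i))
      rw [smul_eq_mul, smul_eq_mul, map_add, map_mul, map_mul, ev_restrict, ev_restrict, ev_restrict,
        ← pd_congr (f := fun z => ext a z * ext b z) (fun z => by
          rw [map_mul, ext_apply, ext_apply])]
      unfold Coord.pd
      rw [fderiv_fun_mul (differentiableAt_ext a y) (differentiableAt_ext b y), ← ext_apply,
        ← ext_apply]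
      rfl

theorem ev_D (i : Fin 4) (a : SmoothFn U) (y : U) : ev y (D i a) = Coord.pd i (ext a) y := rfl

theorem pd_eq {f : E4 → ℝ} {a : SmoothFn U} (h : ∀ z : U, f z = ev z a) (i : Fin 4) (y : U) :
    Coord.pd i f y = ev y (D i a) := pd_congr h i y

theorem D_comm (i j : Fin 4) (a : SmoothFn U) : D i (D j a) = D j (D i a) := by
  have key : ∀ (y : U) (i j : Fin 4), ev y (D i (D j a)) =
      fderiv ℝ (fderiv ℝ (ext a)) y (EuclideanSpace.single i 1) (EuclideanSpace.single j 1) := by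
    intro y i j
    rw [← pd_eq (f := Coord.pd j (ext a)) (fun z => rfl)]
    have hd : DifferentiableAt ℝ (fderiv ℝ (ext a)) y :=
      ((contDiffAt_ext a y).fderiv_right (m := 1) (by norm_cast)).differentiableAt (by simp)
    unfold Coord.pd
    rw [fderiv_clm_apply hd (differentiableAt_const _)]
    simp
  refine ext_ev fun y => ?_
  rw [key, key]
  have := (contDiffAt_ext a y).isSymmSndFDerivAt
    (by simpa only [minSmoothness_of_isRCLikeNormedField] using ENat.LEInfty.out)
  exact this _ _

end SmoothFn

/-! ### Kähler structures in coordinates -/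

namespace Coord

theorem contDiffOn_det {s : Set E4} {M : MatField}
    (h : ∀ a b, ContDiffOn ℝ ∞ (fun y => M y a b) s) :
    ContDiffOn ℝ ∞ (fun y => (M y).det) s := by
  simp only [Matrix.det_apply]
  refine ContDiffOn.sum fun σ _ => ContDiffOn.const_smul _ ?_
  exact contDiffOn_prod fun i _ => h _ _

/-- By Cramer's rule an entry of the inverse is a quotient of two determinants. -/
theorem contDiffOn_ginv {s : Set E4} {M : MatField}
    (h : ∀ a b, ContDiffOn ℝ ∞ (fun y => M y a b) s) (hd : ∀ y ∈ s, (M y).det ≠ 0) (a b : Fin 4) :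
    ContDiffOn ℝ ∞ (fun y => ginv M y a b) s := by
  have e : (fun y => ginv M y a b) = fun y => ((M y).det)⁻¹ *
      ((M y).updateRow b (Pi.single a 1)).det := by
    funext y
    simp only [ginv, Matrix.inv_def, Ring.inverse_eq_inv', Matrix.smul_apply, smul_eq_mul,
      Matrix.adjugate_apply]
  rw [e]
  refine ((contDiffOn_det h).inv hd).mul (contDiffOn_det (M := fun y => (M y).updateRow b (Pi.single a 1)) ?_)
  intro i j
  by_cases hi : i = b
  · subst hi; simpa only [Matrix.updateRow_self] using contDiffOn_const
  · simpa only [Matrix.updateRow_ne hi] using h i j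

/-- `(g, J)` are the components of a Kähler structure on the open set `U`. -/
structure IsKahler (U : Opens E4) (g J : MatField) : Prop where
  smooth_g : ∀ a b, ContDiffOn ℝ ∞ (fun y => g y a b) U
  smooth_J : ∀ a b, ContDiffOn ℝ ∞ (fun y => J y a b) U
  g_symm : ∀ y ∈ U, ∀ a b, g y a b = g y b a
  det_pos : ∀ y ∈ U, 0 < (g y).det
  J_sq : ∀ y ∈ U, J y * J y = -1
  J_g : ∀ y ∈ U, (J y).transpose * g y * J y = g y
  closed : ∀ y ∈ U, ∀ a b c, extd (kform g J) y a b c = 0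
  nij : ∀ y ∈ U, ∀ a b c, nijenhuis J y a b c = 0

namespace IsKahler

open SmoothFn MetricAlg

variable {U : Opens E4} {g J : MatField}

/-- The metric as a structure on the ring of smooth functions. -/
def alg (h : IsKahler U g J) : KahlerAlg (SmoothFn U) where
  D := SmoothFn.D
  D_comm := SmoothFn.D_comm
  g a b := restrict (fun y => g y a b) (h.smooth_g a b)
  gi a b := restrict (fun y => ginv g y a b) (contDiffOn_ginv h.smooth_g (fun y hy => (h.det_pos y hy).ne') a b)
  g_symm a b := ext_ev fun y => h.g_symm y y.2 a b
  gi_symm a b := ext_ev fun y => by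
    have e : (g y).transpose = g y := by ext i j; exact (h.g_symm y y.2 i j).symm
    have : ((g y)⁻¹).transpose = (g y)⁻¹ := by rw [Matrix.transpose_nonsing_inv, e]
    exact (congrFun (congrFun this a) b).symm
  g_gi a b := ext_ev fun y => by
    have := Matrix.mul_nonsing_inv (g y) (isUnit_iff_ne_zero.mpr (h.det_pos y y.2).ne')
    have := congrFun (congrFun this a) b
    simp only [map_sum, map_mul, ev_restrict, ginv]
    rw [Matrix.mul_apply, Matrix.one_apply] at this
    rw [this]; split_ifs <;> simp
  J a b := restrict (fun y => J y a b) (h.smooth_J a b)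
  J_sq a b := ext_ev fun y => by
    have := congrFun (congrFun (h.J_sq y y.2) a) b
    simp only [map_sum, map_mul, ev_restrict]
    rw [Matrix.mul_apply, Matrix.neg_apply, Matrix.one_apply] at this
    rw [this]; split_ifs <;> simp
  J_g a b := ext_ev fun y => by
    have := congrFun (congrFun (h.J_g y y.2) a) b
    simp only [map_sum, map_mul, ev_restrict]
    rw [← this]
    simp only [Matrix.mul_apply, Matrix.transpose_apply, Fin.sum_univ_four]
    ring
  closed a b c := ext_ev fun y => by
    rw [map_zero, ← h.closed y y.2 a b c, extd]
    have e : ∀ b c (z : U), kform g J z b c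
        = ev z (∑ d, restrict (fun y => J y d b) (h.smooth_J d b)
          * restrict (fun y => g y d c) (h.smooth_g d c)) := by
      intro b c z; simp only [map_sum, map_mul, ev_restrict]; rfl
    rw [pd_eq (e b c), pd_eq (e c a), pd_eq (e a b), map_add, map_add]
  nij a b c := ext_ev fun y => by
    rw [map_zero, ← h.nij y y.2 a b c, nijenhuis]
    have e : ∀ i a b, pd i (fun z => J z a b) y
        = ev y (SmoothFn.D i (restrict (fun y => J y a b) (h.smooth_J a b))) :=
      fun i a b => pd_eq (fun z => rfl) i y
    simp only [map_sum, map_sub, map_mul, e, ev_restrict]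

variable (h : IsKahler U g J)

include h

theorem ev_g (y : U) (a b : Fin 4) : ev y (h.alg.g a b) = g y a b := rfl

theorem ev_gi (y : U) (a b : Fin 4) : ev y (h.alg.gi a b) = ginv g y a b := rfl

theorem ev_J (y : U) (a b : Fin 4) : ev y (h.alg.J a b) = J y a b := rfl

theorem alg_D : h.alg.D = SmoothFn.D := rfl

theorem pd_alg {f : E4 → ℝ} {a : SmoothFn U} (hf : ∀ z : U, f z = ev z a) (i : Fin 4) (y : U) :
    pd i f y = ev y (h.alg.D i a) := pd_eq hf i y

theorem pd_g (i a b : Fin 4) (y : U) :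
    pd i (fun z => g z a b) y = ev y (h.alg.D i (h.alg.g a b)) := h.pd_alg (fun _ => rfl) i y

theorem christoffel_eq (y : U) (k i j : Fin 4) : christoffel g y k i j = ev y (h.alg.Γ k i j) := by
  simp only [christoffel, Γ, map_smul, map_sum, map_mul, map_add, map_sub, smul_eq_mul]
  simp only [h.pd_g, ev_gi]

theorem pd_christoffel (a k i j : Fin 4) (y : U) :
    pd a (fun z => christoffel g z k i j) y = ev y (h.alg.D a (h.alg.Γ k i j)) :=
  h.pd_alg (fun z => h.christoffel_eq z k i j) a y

theorem curvUp_eq (y : U) (l k i j : Fin 4) : curvUp g y l k i j = ev y (h.alg.Rup l k i j) := by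
  simp only [curvUp, Rup, map_sum, map_mul, map_add, map_sub]
  simp only [h.pd_christoffel, h.christoffel_eq]

theorem riem_eq (y : U) (i j k l : Fin 4) : riem g y i j k l = ev y (h.alg.Rm i j k l) := by
  simp only [riem, Rm, map_sum, map_mul, h.curvUp_eq, ev_g]

theorem ev_tr (y : U) (T : Fin 4 → Fin 4 → SmoothFn U) :
    ev y (h.alg.tr T) = ∑ i, ∑ j, ginv g y i j * ev y (T i j) := by
  simp only [tr, map_sum, map_mul, ev_gi]

theorem ricci_eq (y : U) (j l : Fin 4) : ricci g y j l = ev y (h.alg.ric j l) := by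
  simp only [ricci, ric, ev_tr, h.riem_eq]

theorem scal_eq (y : U) : scal g y = ev y h.alg.sc := by
  simp only [scal, sc, ev_tr, h.ricci_eq]

theorem weyl_eq (y : U) (i j k l : Fin 4) :
    weyl g y ![i, j, k, l] = (1 / 12) * ev y (h.alg.weyl12 i j k l) := by
  have e12 : ev y (12 : SmoothFn U) = 12 := map_ofNat _ 12
  have e6 : ev y (6 : SmoothFn U) = 6 := map_ofNat _ 6
  have e2 : ev y (2 : SmoothFn U) = 2 := map_ofNat _ 2
  simp only [weyl, weyl12, map_add, map_sub, map_mul, h.riem_eq, h.ricci_eq, h.scal_eq, ev_g,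
    e12, e6, e2, Matrix.cons_val]
  ring

/-- The factor `r` lets the components be compared with the integral multiples of the abstract
tensors, such as `weyl12` with r = 1/12. -/
theorem pd_const_mul (r : ℝ) {f : E4 → ℝ} {a : SmoothFn U} (hf : ∀ z : U, f z = r * ev z a)
    (i : Fin 4) (y : U) : pd i f y = r * ev y (h.alg.D i a) := by
  rw [h.pd_alg (a := r • a) (fun z => by rw [hf, map_smul, smul_eq_mul]), Derivation.map_smul, map_smul,
    smul_eq_mul]

theorem cov_two (r : ℝ) {T : CovTensor 2} {T' : Fin 4 → Fin 4 → SmoothFn U}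
    (hT : ∀ (z : U) a b, T z ![a, b] = r * ev z (T' a b)) (y : U) (i a b : Fin 4) :
    cov g T y ![i, a, b] = r * ev y (h.alg.c2 T' i a b) := by
  have t : Fin.tail ![i, a, b] = ![a, b] := rfl
  have u0 : ∀ m, Function.update ![a, b] 0 m = ![m, b] := fun m => by
    ext p; fin_cases p <;> rfl
  have u1 : ∀ m, Function.update ![a, b] 1 m = ![a, m] := fun m => by
    ext p; fin_cases p <;> rfl
  simp only [cov, t, Fin.sum_univ_two, u0, u1, hT, h.christoffel_eq]
  rw [h.pd_const_mul r (fun z => hT z _ _)]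
  simp only [c2, map_sub, map_add, map_mul, Fin.sum_univ_four]
  simp only [Matrix.cons_val, Fin.succ_zero_eq_one, Fin.succ_one_eq_two]
  ring

theorem cov_four (r : ℝ) {T : CovTensor 4} {T' : Fin 4 → Fin 4 → Fin 4 → Fin 4 → SmoothFn U}
    (hT : ∀ (z : U) a b c d, T z ![a, b, c, d] = r * ev z (T' a b c d)) (y : U)
    (i a b c d : Fin 4) :
    cov g T y ![i, a, b, c, d] = r * ev y (h.alg.c4 T' i a b c d) := by
  have t : Fin.tail ![i, a, b, c, d] = ![a, b, c, d] := rfl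
  have u0 : ∀ m, Function.update ![a, b, c, d] 0 m = ![m, b, c, d] := fun m => by
    ext p; fin_cases p <;> rfl
  have u1 : ∀ m, Function.update ![a, b, c, d] 1 m = ![a, m, c, d] := fun m => by
    ext p; fin_cases p <;> rfl
  have u2 : ∀ m, Function.update ![a, b, c, d] 2 m = ![a, b, m, d] := fun m => by
    ext p; fin_cases p <;> rfl
  have u3 : ∀ m, Function.update ![a, b, c, d] 3 m = ![a, b, c, m] := fun m => by
    ext p; fin_cases p <;> rfl
  have v : ∀ p : Fin 4, (![i, a, b, c, d] : Fin 5 → Fin 4) p.succ = ![a, b, c, d] p :=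
    fun p => rfl
  have v0 : (![i, a, b, c, d] : Fin 5 → Fin 4) 0 = i := rfl
  unfold cov
  rw [Fin.sum_univ_four]
  simp only [t, u0, u1, u2, u3, hT, h.christoffel_eq, v, v0]
  rw [h.pd_const_mul r (fun z => hT z _ _ _ _)]
  simp only [c4, map_sub, map_add, map_mul, Fin.sum_univ_four]
  simp only [Matrix.cons_val]
  ring

theorem cov_five (r : ℝ) {T : CovTensor 5}
    {T' : Fin 4 → Fin 4 → Fin 4 → Fin 4 → Fin 4 → SmoothFn U}
    (hT : ∀ (z : U) a b c d e, T z ![a, b, c, d, e] = r * ev z (T' a b c d e)) (y : U)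
    (i a b c d e : Fin 4) :
    cov g T y ![i, a, b, c, d, e] = r * ev y (h.alg.c5 T' i a b c d e) := by
  have t : Fin.tail ![i, a, b, c, d, e] = ![a, b, c, d, e] := rfl
  have u0 : ∀ m, Function.update ![a, b, c, d, e] 0 m = ![m, b, c, d, e] := fun m => by
    ext p; fin_cases p <;> rfl
  have u1 : ∀ m, Function.update ![a, b, c, d, e] 1 m = ![a, m, c, d, e] := fun m => by
    ext p; fin_cases p <;> rfl
  have u2 : ∀ m, Function.update ![a, b, c, d, e] 2 m = ![a, b, m, d, e] := fun m => by
    ext p; fin_cases p <;> rfl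
  have u3 : ∀ m, Function.update ![a, b, c, d, e] 3 m = ![a, b, c, m, e] := fun m => by
    ext p; fin_cases p <;> rfl
  have u4 : ∀ m, Function.update ![a, b, c, d, e] 4 m = ![a, b, c, d, m] := fun m => by
    ext p; fin_cases p <;> rfl
  have v : ∀ p : Fin 5, (![i, a, b, c, d, e] : Fin 6 → Fin 4) p.succ = ![a, b, c, d, e] p :=
    fun p => rfl
  have v0 : (![i, a, b, c, d, e] : Fin 6 → Fin 4) 0 = i := rfl
  unfold cov
  rw [Fin.sum_univ_five]
  simp only [t, u0, u1, u2, u3, u4, hT, h.christoffel_eq, v, v0]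
  rw [h.pd_const_mul r (fun z => hT z _ _ _ _ _)]
  simp only [c5, map_sub, map_add, map_mul, Fin.sum_univ_four]
  simp only [Matrix.cons_val]
  ring

end IsKahler
end Coord

/-! ### Pointwise algebra of 2-forms in dimension four -/

/-- The Pfaffian of an antisymmetric `4 × 4` matrix. -/
def pfaffian (w : Fin 4 → Fin 4 → ℝ) : ℝ := w 0 1 * w 2 3 - w 0 2 * w 1 3 + w 0 3 * w 1 2

theorem det_eq_pfaffian_sq {w : Matrix (Fin 4) (Fin 4) ℝ} (hw : ∀ a b, w a b = -w b a) :
    w.det = pfaffian w ^ 2 := by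
  rw [Matrix.det_succ_row_zero]
  simp only [Matrix.det_fin_three, Fin.sum_univ_four, Matrix.submatrix_apply, pfaffian]
  simp [Fin.succAbove, Fin.succ, diag_zero_of_antisymm hw, hw 1 0, hw 2 0, hw 3 0, hw 2 1, hw 3 1, hw 3 2]
  ring

set_option maxHeartbeats 1000000 in
theorem pfaffian_conj {w : Fin 4 → Fin 4 → ℝ} (hw : ∀ a b, w a b = -w b a)
    (M : Matrix (Fin 4) (Fin 4) ℝ) :
    pfaffian (fun a b => ∑ c, ∑ d, M a c * M b d * w c d) = M.det * pfaffian w := by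
  rw [Matrix.det_succ_row_zero]
  simp only [Matrix.det_fin_three, Fin.sum_univ_four, Matrix.submatrix_apply, pfaffian]
  simp only [Fin.succAbove, Fin.succ, diag_zero_of_antisymm hw, hw 1 0, hw 2 0, hw 3 0, hw 2 1,
    hw 3 1, hw 3 2]
  simp
  ring

/-- `eps` is the determinant of the 0-1 matrix of the index map, and conjugating `w` by that matrix
merely selects entries; the claim is thus a case of `pfaffian_conj`. -/
theorem pfaffian_mul_eps {w : Fin 4 → Fin 4 → ℝ} (hw : ∀ a b, w a b = -w b a) (i j k l : Fin 4) :
    pfaffian w * Coord.eps i j k l = w i j * w k l - w i k * w j l + w i l * w j k := by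
  rw [Coord.eps, mul_comm, ← pfaffian_conj hw]
  have e : ∀ I : Fin 4 → Fin 4, ∀ p q : Fin 4, ∑ c, ∑ d, (Matrix.of fun a b : Fin 4 =>
      if I a = b then (1 : ℝ) else 0) p c * (Matrix.of fun a b : Fin 4 =>
      if I a = b then (1 : ℝ) else 0) q d * w c d = w (I p) (I q) := by
    intro I p q
    simp only [Matrix.of_apply]
    rw [Finset.sum_eq_single (I p), Finset.sum_eq_single (I q)]
    · simp
    · intro b _ hb; simp [hb.symm]
    · simp
    · intro b _ hb; simp [hb.symm]
    · simp
  simp only [e]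
  rfl

/-- The cyclic sum C of `T` is a 3-form. The hypotheses force its contraction with `W` to vanish.
Contracting once more with a row of `W` isolates a single component of C with coefficient ± Pf `W`,
so the contraction is injective when `W` is nondegenerate. -/
theorem pfaffian_mul_cyclic {W : Fin 4 → Fin 4 → ℝ} {T : Fin 4 → Fin 4 → Fin 4 → ℝ}
    (hW : ∀ a b, W a b = -W b a) (hT : ∀ a b c, T a b c = -T a c b)
    (h1 : ∀ c, ∑ a, ∑ b, W a b * T a b c = 0) (h2 : ∀ a, ∑ b, ∑ c, W b c * T a b c = 0)
    (a b c : Fin 4) : pfaffian W * (T a b c + T b c a + T c a b) = 0 := by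
  have d : ∀ a b, T a b b = 0 := fun a => diag_zero_of_antisymm (hT a)
  have t1 := fun a => hT a 1 0
  have t2 := fun a => hT a 2 0
  have t3 := fun a => hT a 3 0
  have t4 := fun a => hT a 2 1
  have t5 := fun a => hT a 3 1
  have t6 := fun a => hT a 3 2
  have p0 := h1 0
  have p1 := h1 1
  have p2 := h1 2
  have p3 := h1 3
  have q0 := h2 0
  have q1 := h2 1
  have q2 := h2 2
  have q3 := h2 3
  simp only [Fin.sum_univ_four, diag_zero_of_antisymm hW, hW 1 0, hW 2 0, hW 3 0, hW 2 1, hW 3 1,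
    hW 3 2, d, t1, t2, t3, t4, t5, t6] at p0 p1 p2 p3 q0 q1 q2 q3
  -- Each `p c + q c / 2` is half the contraction of `W` with C; the coefficients are the entries of
  -- row 0 of `W`, and similarly for the other three components.
  have k0 : pfaffian W * (T 1 2 3 + T 2 3 1 + T 3 1 2) = 0 := by
    simp only [pfaffian, t5]
    linear_combination W 0 1 * (q1 / 2 + p1) + W 0 2 * (q2 / 2 + p2) + W 0 3 * (q3 / 2 + p3)
  have k1 : pfaffian W * (T 0 2 3 + T 2 3 0 + T 3 0 2) = 0 := by
    simp only [pfaffian, t3]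
    linear_combination W 0 1 * (q0 / 2 + p0) - W 1 2 * (q2 / 2 + p2) - W 1 3 * (q3 / 2 + p3)
  have k2 : pfaffian W * (T 0 1 3 + T 1 3 0 + T 3 0 1) = 0 := by
    simp only [pfaffian, t3]
    linear_combination -W 0 2 * (q0 / 2 + p0) - W 1 2 * (q1 / 2 + p1) + W 2 3 * (q3 / 2 + p3)
  have k3 : pfaffian W * (T 0 1 2 + T 1 2 0 + T 2 0 1) = 0 := by
    simp only [pfaffian, t2]
    linear_combination W 0 3 * (q0 / 2 + p0) + W 1 3 * (q1 / 2 + p1) + W 2 3 * (q2 / 2 + p2)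
  simp only [t2, t3, t5] at k0 k1 k2 k3
  clear p0 p1 p2 p3 q0 q1 q2 q3 h1 h2
  generalize pfaffian W = x at *
  -- Up to antisymmetry each index triple either has a repetition, where the sum vanishes
  -- identically, or is one of the four above with a sign.
  fin_cases a <;> fin_cases b <;> fin_cases c <;>
    simp only [Fin.zero_eta, Fin.isValue, Fin.mk_one, Fin.reduceFinMk, d, t1, t2, t3, t4, t5, t6] <;>
    first
      | ring1
      | linear_combination k0
      | linear_combination k1
      | linear_combination k2
      | linear_combination k3
      | linear_combination -k0
      | linear_combination -k1
      | linear_combination -k2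
      | linear_combination -k3

/-! ### The 2-form ψ: type, anti-self-duality, divergence and contractions with J g⁻¹. -/

namespace KahlerAlg

open MetricAlg

variable {A : Type*} [CommRing A] [Algebra ℝ A] (K : KahlerAlg A)

theorem sum_bivec (T : Fin 4 → Fin 4 → A) :
    ∑ a, ∑ b, K.bivec a b * T a b = K.tr fun i k => K.jj (fun m => T m k) i := by
  simp only [tr, jj, bivec, Fin.sum_univ_four]; ring

/-- The 2-form `24 B(J·, ·)`. -/
def psi24 (a b : Fin 4) : A := K.jj (fun c => K.bach24 c b) a

theorem psi24_antisymm (hK : K.IsExtremal) (a b : Fin 4) : K.psi24 a b = -K.psi24 b a := by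
  unfold psi24
  rw [K.bach24_jj hK]
  congr 2; funext c; rw [K.bach24_symm]

theorem c2_psi24 (i a b : Fin 4) :
    K.c2 K.psi24 i a b = K.jj (fun c => K.c2 K.bach24 i c b) a := K.c2_jj K.bach24 i a b

/-- Contraction with J g⁻¹ undoes the J in ψ, so this is the divergence of B. Its companion for the
last two indices is the derivative of the trace of B. -/
theorem sum_bivec_c2_psi24 (hK : K.IsExtremal) (c : Fin 4) :
    ∑ a, ∑ b, K.bivec a b * K.c2 K.psi24 a b c = 0 := by
  rw [K.sum_bivec (fun a b => K.c2 K.psi24 a b c), K.tr_jj (fun a b => K.c2 K.psi24 a b c)]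
  have e : (fun i k => K.jj (fun b => K.c2 K.psi24 i b c) k)
      = fun i k => -K.c2 K.bach24 i k c := by
    funext i k
    simp only [c2_psi24]
    exact K.jj_jj (fun e => K.c2 K.bach24 i e c) k
  rw [e, tr_neg, K.div_bach24 hK, neg_zero, neg_zero]

theorem sum_bivec_c2_psi24_right (a : Fin 4) :
    ∑ b, ∑ c, K.bivec b c * K.c2 K.psi24 a b c = 0 := by
  rw [K.sum_bivec (fun b c => K.c2 K.psi24 a b c)]
  have e : (fun i k => K.jj (fun b => K.c2 K.psi24 a b k) i)
      = fun i k => -K.c2 K.bach24 a i k := by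
    funext i k
    simp only [c2_psi24]
    exact K.jj_jj (fun e => K.c2 K.bach24 a e k) i
  rw [e, tr_neg]
  have : K.tr (fun i k => K.c2 K.bach24 a i k) = K.D a (K.tr K.bach24) := (K.D_tr a _).symm
  rw [this, tr_bach24, map_zero, neg_zero]

theorem div_psi24 (hK : K.IsExtremal) (b : Fin 4) :
    (K.tr fun m a => K.c2 K.psi24 m a b) = 0 := by
  have e : (fun m a => K.c2 K.psi24 m a b) = fun m a =>
      -K.jj (fun c => K.c2 K.bach24 m a c) b := by
    funext m a
    rw [K.c2_antisymm K.psi24 (K.psi24_antisymm hK), c2_psi24]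
    congr 2; funext c; exact K.c2_symm _ K.bach24_symm m c a
  rw [e, tr_neg, ← K.jj_tr (fun c m a => K.c2 K.bach24 m a c)]
  simp only [K.div_bach24 hK, jj_zero, neg_zero]

/-- The exterior derivative of a 2-form in terms of the covariant derivative. -/
theorem cyclic_c2 (T : Fin 4 → Fin 4 → A) (hT : ∀ a b, T a b = -T b a) (a b c : Fin 4) :
    K.c2 T a b c + K.c2 T b c a + K.c2 T c a b
      = K.D a (T b c) + K.D b (T c a) + K.D c (T a b) := by
  have e : ∀ i a b, K.c2 T i a b = K.D i (T a b) - ∑ m, K.Γ m i a * T m b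
      + ∑ m, K.Γ m i b * T m a := by
    intro i a b
    simp only [c2, fun m => hT a m, mul_neg, Finset.sum_neg_distrib]; ring
  simp only [e, fun m => K.Γ_symm m b a, fun m => K.Γ_symm m c a, fun m => K.Γ_symm m c b]
  ring

theorem om_gi (i m : Fin 4) : ∑ k, K.om i k * K.gi k m = K.J m i := by
  have : ∑ k, K.om i k * K.gi k m = ∑ c, K.J c i * ∑ k, K.g c k * K.gi k m := by
    simp only [om, jj, Fin.sum_univ_four]; ring
  rw [this]
  simp [K.g_gi]

/-- Both indices raised. -/
def raise (T : Fin 4 → Fin 4 → A) (i j : Fin 4) : A :=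
  ∑ m, ∑ n, K.gi i m * K.gi j n * T m n

theorem sum_om_om_raise (T : Fin 4 → Fin 4 → A) (i j : Fin 4) :
    ∑ k, ∑ l, K.om i k * K.om j l * K.raise T k l = K.jj (fun c => K.jj (T c) j) i := by
  have : ∑ k, ∑ l, K.om i k * K.om j l * K.raise T k l =
      ∑ m, ∑ n, (∑ k, K.om i k * K.gi k m) * (∑ l, K.om j l * K.gi l n) * T m n := by
    simp only [raise, Fin.sum_univ_four]; ring
  rw [this]
  simp only [om_gi]
  simp only [jj, Fin.sum_univ_four]; ring

theorem sum_om_raise (T : Fin 4 → Fin 4 → A) :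
    ∑ k, ∑ l, K.om k l * K.raise T k l = -∑ a, ∑ b, K.bivec a b * T a b := by
  have : ∑ k, ∑ l, K.om k l * K.raise T k l =
      ∑ m, ∑ n, (∑ k, (∑ l, K.om k l * K.gi l n) * K.gi k m) * T m n := by
    simp only [raise, Fin.sum_univ_four]; ring
  rw [this, ← Finset.sum_neg_distrib]
  refine Finset.sum_congr rfl fun m _ => ?_
  rw [← Finset.sum_neg_distrib]
  refine Finset.sum_congr rfl fun n _ => ?_
  simp only [om_gi]
  rw [K.bivec_antisymm m n, bivec]
  ring

/-- The minus sign makes Λ the contraction with -(J g⁻¹)/2, so that Λω = 2 is positive. -/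
theorem raise_om (a b : Fin 4) : K.raise K.om a b = -K.bivec a b := by
  have : K.raise K.om a b = ∑ m, K.gi a m * ∑ n, K.om m n * K.gi n b := by
    simp only [raise, Fin.sum_univ_four, K.gi_symm b]; ring
  rw [this]
  simp only [om_gi]
  rw [K.bivec_antisymm a b, neg_neg, bivec]
  exact Finset.sum_congr rfl fun c _ => by rw [K.gi_symm, mul_comm]

/-- A primitive (1,1)-form is anti-self-dual. -/
theorem star_primitive (T : Fin 4 → Fin 4 → A)
    (h11 : ∀ a b, K.jj (fun c => K.jj (T c) b) a = T a b) (hT : ∀ a b, T a b = -T b a)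
    (h0 : ∑ a, ∑ b, K.bivec a b * T a b = 0) (i j : Fin 4) :
    ∑ k, ∑ l, (K.om i j * K.om k l - K.om i k * K.om j l + K.om i l * K.om j k) * K.raise T k l
      = -2 * T i j := by
  have e : ∑ k, ∑ l, (K.om i j * K.om k l - K.om i k * K.om j l + K.om i l * K.om j k)
      * K.raise T k l = K.om i j * ∑ k, ∑ l, K.om k l * K.raise T k l
      - ∑ k, ∑ l, K.om i k * K.om j l * K.raise T k l
      + ∑ k, ∑ l, K.om i l * K.om j k * K.raise T k l := by
    simp only [Finset.mul_sum, ← Finset.sum_sub_distrib, ← Finset.sum_add_distrib]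
    exact Finset.sum_congr rfl fun k _ => Finset.sum_congr rfl fun l _ => by ring
  have e2 : ∀ k l, K.raise T l k = -K.raise T k l := by
    intro k l
    unfold raise
    rw [Finset.sum_comm, ← Finset.sum_neg_distrib]
    refine Finset.sum_congr rfl fun m _ => ?_
    rw [← Finset.sum_neg_distrib]
    exact Finset.sum_congr rfl fun n _ => by rw [hT n m]; ring
  have e3 : ∑ k, ∑ l, K.om i l * K.om j k * K.raise T k l
      = -∑ k, ∑ l, K.om i k * K.om j l * K.raise T k l := by
    rw [Finset.sum_comm, ← Finset.sum_neg_distrib]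
    refine Finset.sum_congr rfl fun k _ => ?_
    rw [← Finset.sum_neg_distrib]
    exact Finset.sum_congr rfl fun l _ => by rw [e2 k l, mul_neg]
  -- The first term vanishes as `T` is primitive; each of the other two contributes -`T` because `T`
  -- is an antisymmetric (1,1)-form.
  rw [e, e3, sum_om_raise, h0, sum_om_om_raise, h11]
  ring

theorem psi24_jj_jj (hK : K.IsExtremal) (a b : Fin 4) :
    K.jj (fun c => K.jj (K.psi24 c) b) a = K.psi24 a b := by
  have e : (fun c => K.jj (K.psi24 c) b) = fun c => K.bach24 c b := by
    funext c
    have e2 : K.psi24 c = fun d => -K.jj (K.bach24 c) d := by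
      funext d; exact K.bach24_jj hK c d
    rw [e2, jj_neg]
    have := K.jj_jj (K.bach24 c) b
    rw [this, neg_neg]
  rw [e]; rfl

theorem sum_bivec_psi24 : ∑ a, ∑ b, K.bivec a b * K.psi24 a b = 0 := by
  rw [K.sum_bivec]
  have e : (fun i k => K.jj (fun m => K.psi24 m k) i) = fun i k => -K.bach24 i k := by
    funext i k; exact K.jj_jj (fun e => K.bach24 e k) i
  rw [e, tr_neg]
  have : K.tr (fun i k => K.bach24 i k) = 0 := K.tr_bach24
  rw [this, neg_zero]

theorem c1_jj (f : Fin 4 → A) (i a : Fin 4) :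
    K.c1 (K.jj f) i a = K.jj (fun c => K.c1 f i c) a := by
  simp only [c1, jj, Fin.sum_univ_four, map_add, Derivation.leibniz, smul_eq_mul, D_J]
  ring

/-- The exterior derivative is the antisymmetrised covariant one. Since J is parallel, its two terms
are Hess s with J in one index or the other, and extremality makes them add up. -/
theorem D_jj_ds (hK : K.IsExtremal) (a b : Fin 4) :
    K.D a (K.jj K.ds b) - K.D b (K.jj K.ds a) = -2 * K.jj (fun c => K.hess c b) a := by
  have h1 := K.c1_jj K.ds a b
  have h2 := K.c1_jj K.ds b a
  have e1 : K.jj (fun c => K.c1 K.ds a c) b = -K.jj (fun c => K.hess c b) a := by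
    rw [K.hess_jj hK, neg_neg]; rfl
  have e2 : K.jj (fun c => K.c1 K.ds b c) a = K.jj (fun c => K.hess c b) a := by
    congr 1; funext c; exact K.hess_symm b c
  rw [e1] at h1
  rw [e2] at h2
  simp only [c1] at h1 h2
  simp only [K.Γ_symm _ b a] at h2
  linear_combination h1 - h2

/-- The form `s ρ + 2 i ∂∂̄ s` of an extremal Kähler metric. -/
def scalRho (a b : Fin 4) : A :=
  K.sc * K.rho a b + 2 * K.jj (fun c => K.hess c b) a

theorem sum_bivec_scalRho :
    ∑ a, ∑ b, K.bivec a b * K.scalRho a b = -(K.sc ^ 2 + 2 * K.lap) := by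
  rw [K.sum_bivec]
  have e : (fun i k => K.jj (fun m => K.scalRho m k) i)
      = fun i k => -(K.sc * K.ric i k + 2 * K.hess i k) := by
    funext i k
    unfold scalRho
    rw [jj_add, jj_mul_left, jj_mul_left]
    have h1 : K.jj (fun m => K.rho m k) i = -K.ric i k := K.jj_jj (fun e => K.ric e k) i
    have h2 : K.jj (fun m => K.jj (fun c => K.hess c k) m) i = -K.hess i k :=
      K.jj_jj (fun e => K.hess e k) i
    rw [h1, h2]; ring
  rw [e, tr_neg, tr_add, tr_mul_left, tr_mul_left]
  have h1 : K.tr (fun i k => K.ric i k) = K.sc := rfl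
  have h2 : K.tr (fun i k => K.hess i k) = K.lap := rfl
  rw [h1, h2]; ring

theorem psi24_eq (a b : Fin 4) :
    K.psi24 a b = 4 * K.scalRho a b - (K.sc ^ 2 + 2 * K.lap) * K.om a b := by
  unfold psi24 scalRho rho om
  simp only [← jj_mul_left, ← jj_add, ← jj_sub]
  congr 1; funext c
  unfold bach24; ring

end KahlerAlg

/-! ### Transfer of the abstract identities to tensor components in coordinates. -/

namespace Coord
namespace IsKahler

open SmoothFn MetricAlg

variable {U : Opens E4} {g J : MatField} (h : IsKahler U g J)

include h

theorem isExtremal (hE : ∀ y ∈ U, ∀ a b, lieEnd (grad g (scal g)) J y a b = 0) :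
    h.alg.IsExtremal := by
  intro a b
  refine ext_ev fun y => ?_
  have hx : ∀ (z : U) a, grad g (scal g) z a = ev z (h.alg.xi a) := by
    intro z a
    simp only [grad, KahlerAlg.xi, map_sum, map_mul, ev_gi]
    exact Finset.sum_congr rfl fun b _ => by rw [h.pd_alg h.scal_eq]; rfl
  have hJ : ∀ c a b, pd c (fun z => J z a b) y = ev y (h.alg.D c (h.alg.J a b)) :=
    fun c a b => h.pd_alg (fun _ => rfl) c y
  have hpx : ∀ c a, pd c (fun z => grad g (scal g) z a) y = ev y (h.alg.D c (h.alg.xi a)) :=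
    fun c a => h.pd_alg (fun z => hx z a) c y
  rw [map_zero, ← hE y y.2 a b, lieEnd]
  simp only [map_sum, map_add, map_sub, map_mul, hx, hJ, hpx, ev_J]

theorem bach_eq (hE : h.alg.IsExtremal) (y : U) (a b : Fin 4) :
    bach g y a b = (1 / 24) * ev y (h.alg.bach24 a b) := by
  have e2 : ev y (2 : SmoothFn U) = 2 := map_ofNat _ 2
  have hc : ∀ m n a c b d, cov g (cov g (weyl g)) y ![m, n, a, c, b, d]
      = (1 / 12) * ev y (h.alg.c5 (h.alg.c4 h.alg.weyl12) m n a c b d) := fun m n a c b d =>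
    h.cov_five (1 / 12) (fun z a b c d e =>
      h.cov_four (1 / 12) (fun z a b c d => h.weyl_eq z a b c d) z a b c d e) y m n a c b d
  -- Reorders the four summations of the definition of the Bach tensor into two nested metric
  -- traces.
  have key : ∀ X : Fin 4 → Fin 4 → Fin 4 → Fin 4 → ℝ,
      ∑ c, ∑ d, ∑ m, ∑ n, ginv g y c m * ginv g y d n * X m n c d
        = ∑ m, ∑ c, ginv g y m c * ∑ n, ∑ d, ginv g y n d * X m n c d := by
    intro X
    have hs : ∀ a b, ginv g y a b = ginv g y b a := fun a b => by
      rw [← h.ev_gi, h.alg.gi_symm, ev_gi]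
    simp only [Finset.mul_sum]
    rw [Finset.sum_congr rfl fun c _ => Finset.sum_comm, Finset.sum_comm]
    refine Finset.sum_congr rfl fun m _ => Finset.sum_congr rfl fun c _ => ?_
    rw [Finset.sum_comm]
    refine Finset.sum_congr rfl fun n _ => Finset.sum_congr rfl fun d _ => ?_
    rw [hs c m, hs d n]; ring
  rw [← h.alg.bach_formula hE]
  simp only [map_add, map_mul, e2, ev_tr]
  rw [← key, ← key]
  simp only [bach, hc, raise, h.ricci_eq, h.weyl_eq, Finset.mul_sum, Finset.sum_mul,
    ← Finset.sum_add_distrib]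
  refine Finset.sum_congr rfl fun c _ => Finset.sum_congr rfl fun d _ =>
    Finset.sum_congr rfl fun m _ => Finset.sum_congr rfl fun n _ => ?_
  ring

theorem psi_eq (hE : h.alg.IsExtremal) (y : U) (a b : Fin 4) :
    appL J (bach g) y a b = (1 / 24) * ev y (h.alg.psi24 a b) := by
  simp only [appL, h.bach_eq hE, KahlerAlg.psi24, KahlerAlg.jj, map_sum, map_mul, ev_J,
    Finset.mul_sum]
  exact Finset.sum_congr rfl fun c _ => by ring

theorem kform_eq (y : U) (a b : Fin 4) : kform g J y a b = ev y (h.alg.om a b) := by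
  simp only [kform, appL, KahlerAlg.om, KahlerAlg.jj, map_sum, map_mul, ev_J, ev_g]

theorem raise_eq (r : ℝ) {T : Bilin} {T' : Fin 4 → Fin 4 → SmoothFn U} (y : U)
    (hT : ∀ a b, T y a b = r * ev y (T' a b)) (a b : Fin 4) :
    raise g T y a b = r * ev y (h.alg.raise T' a b) := by
  simp only [raise, KahlerAlg.raise, map_sum, map_mul, ev_gi, hT, Finset.mul_sum]
  exact Finset.sum_congr rfl fun c _ => Finset.sum_congr rfl fun d _ => by ring

/-- The matrix of ω is Jᵀ g, so its determinant Pf(ω)² equals det J · det g. From J² = -1 comes (det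
J)² = 1, and the sign is positive because a square cannot be negative while det g > 0. -/
theorem halfSquare_sq (y : U) : halfSquare (kform g J) y ^ 2 = (g y).det := by
  have hk : ∀ a b, kform g J y a b = -kform g J y b a := by
    intro a b; rw [h.kform_eq, h.kform_eq, h.alg.om_antisymm, map_neg]
  have e1 : Matrix.of (kform g J y) = (J y).transpose * g y := by
    ext a b; simp only [kform, appL, Matrix.of_apply, Matrix.mul_apply, Matrix.transpose_apply]
  have e2 := det_eq_pfaffian_sq (w := Matrix.of (kform g J y)) hk
  have e3 : pfaffian (Matrix.of (kform g J y)) = halfSquare (kform g J) y := rfl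
  rw [e1, Matrix.det_mul, Matrix.det_transpose, ← e1, e3] at e2
  have e4 : (J y).det * (J y).det = 1 := by
    rw [← Matrix.det_mul, h.J_sq y y.2, Matrix.det_neg]; simp; norm_num
  have e5 := h.det_pos y y.2
  have e6 : 0 ≤ (J y).det := by
    by_contra hn
    push Not at hn
    nlinarith [mul_neg_of_neg_of_pos hn e5, sq_nonneg (halfSquare (kform g J) y)]
  have e7 : (J y).det = 1 := by nlinarith
  rw [← e2, e7, one_mul]

/-- The volume form for the complex orientation is ω ∧ ω / 2: the sign of Pf(ω) times √(det g) =
|Pf(ω)| is Pf(ω), and `pfaffian_mul_eps` expands the result. The Hodge star thereby becomes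
polynomial in ω. -/
theorem vol_eq (y : U) (i j k l : Fin 4) : vol g J y i j k l =
    ev y (h.alg.om i j * h.alg.om k l - h.alg.om i k * h.alg.om j l
      + h.alg.om i l * h.alg.om j k) := by
  have hk : ∀ a b, kform g J y a b = -kform g J y b a := by
    intro a b; rw [h.kform_eq, h.kform_eq, h.alg.om_antisymm, map_neg]
  have e := pfaffian_mul_eps hk i j k l
  simp only [map_add, map_sub, map_mul, ← h.kform_eq]
  rw [← e, vol, ← h.halfSquare_sq, Real.sqrt_sq_eq_abs]
  congr 1
  rcases lt_trichotomy (halfSquare (kform g J) y) 0 with hn | hn | hn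
  · rw [Real.sign_of_neg hn, abs_of_neg hn, neg_one_mul, neg_neg]; rfl
  -- This case does not occur, but both sides are zero in it anyway.
  · rw [hn, abs_zero, mul_zero, ← hn]; rfl
  · rw [Real.sign_of_pos hn, abs_of_pos hn, one_mul]; rfl

theorem hodge_psi (hE : h.alg.IsExtremal) (y : U) (a b : Fin 4) :
    hodge g J (appL J (bach g)) y a b = -appL J (bach g) y a b := by
  have e2 : ev y (2 : SmoothFn U) = 2 := map_ofNat _ 2
  have key := congrArg (ev y) (h.alg.star_primitive h.alg.psi24 (h.alg.psi24_jj_jj hE)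
    (h.alg.psi24_antisymm hE) h.alg.sum_bivec_psi24 a b)
  simp only [hodge, h.raise_eq (1 / 24) y (h.psi_eq hE y), h.vol_eq, h.psi_eq hE]
  rw [map_mul, map_neg, e2] at key
  simp only [map_sum, map_mul] at key ⊢
  have : ∀ k l (x : ℝ), x * (1 / 24 * ev y (h.alg.raise h.alg.psi24 k l))
      = 1 / 24 * (x * ev y (h.alg.raise h.alg.psi24 k l)) := fun k l x => by ring
  simp only [this, ← Finset.mul_sum, key]
  ring

/-- At each point `pfaffian_mul_cyclic` applies to J g⁻¹ and ∇ψ; the Pfaffian of J g⁻¹ is nonzero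
because its square is det J / det g. -/
theorem extd_psi (hE : h.alg.IsExtremal) (y : U) (a b c : Fin 4) :
    extd (appL J (bach g)) y a b c = 0 := by
  have hp : ∀ i a b, pd i (fun z => appL J (bach g) z a b) y
      = 1 / 24 * ev y (h.alg.D i (h.alg.psi24 a b)) := fun i a b =>
    h.pd_const_mul (1 / 24) (fun z => h.psi_eq hE z a b) i y
  have e : extd (appL J (bach g)) y a b c = 1 / 24 * ev y (h.alg.c2 h.alg.psi24 a b c
      + h.alg.c2 h.alg.psi24 b c a + h.alg.c2 h.alg.psi24 c a b) := by
    rw [extd, hp, hp, hp, h.alg.cyclic_c2 _ (h.alg.psi24_antisymm hE), map_add, map_add]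
    ring
  let W : Fin 4 → Fin 4 → ℝ := fun a b => ev y (h.alg.bivec a b)
  have hW : ∀ a b, W a b = -W b a := fun a b => by
    simp only [W]; rw [h.alg.bivec_antisymm, map_neg]
  have key := pfaffian_mul_cyclic (W := W) (T := fun a b c => ev y (h.alg.c2 h.alg.psi24 a b c))
    hW (fun a b c => by rw [h.alg.c2_antisymm _ (h.alg.psi24_antisymm hE), map_neg])
    (fun c => by
      have := congrArg (ev y) (h.alg.sum_bivec_c2_psi24 hE c)
      simpa only [map_sum, map_mul, map_zero] using this)
    (fun a => by
      have := congrArg (ev y) (h.alg.sum_bivec_c2_psi24_right a)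
      simpa only [map_sum, map_mul, map_zero] using this) a b c
  have hpf : pfaffian W ≠ 0 := by
    intro h0
    have e1 : Matrix.of W = J y * (g y)⁻¹ := by
      ext a b
      simp only [W, KahlerAlg.bivec, map_sum, map_mul, ev_J, ev_gi, Matrix.of_apply,
        Matrix.mul_apply, ginv]
    have e2 := det_eq_pfaffian_sq (w := Matrix.of W) hW
    have e3 : pfaffian (Matrix.of W) = pfaffian W := rfl
    rw [e3, h0, e1, Matrix.det_mul] at e2
    have e4 : (J y).det * (J y).det = 1 := by
      rw [← Matrix.det_mul, h.J_sq y y.2, Matrix.det_neg]; simp; norm_num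
    have e5 : ((g y)⁻¹).det ≠ 0 := by
      rw [Matrix.det_nonsing_inv, Ring.inverse_eq_inv']
      exact inv_ne_zero (h.det_pos y y.2).ne'
    rcases mul_eq_zero.mp (e2.trans (by norm_num)) with h1 | h1
    · rw [h1] at e4; norm_num at e4
    · exact e5 h1
  rw [e, map_add, map_add]
  rw [(mul_eq_zero.mp key).resolve_left hpf, mul_zero]

theorem codiff_psi (hE : h.alg.IsExtremal) (y : U) (b : Fin 4) :
    codiff g (appL J (bach g)) y b = 0 := by
  have hc : ∀ m a b, cov g (k := 2) (fun z I => appL J (bach g) z (I 0) (I 1)) y ![m, a, b]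
      = 1 / 24 * ev y (h.alg.c2 h.alg.psi24 m a b) := fun m a b =>
    h.cov_two (1 / 24) (fun z a b => h.psi_eq hE z a b) y m a b
  have key := congrArg (ev y) (h.alg.div_psi24 hE b)
  rw [ev_tr, map_zero, Finset.sum_comm] at key
  have hs : ∀ a b, ginv g y a b = ginv g y b a := fun a b => by
    rw [← h.ev_gi, h.alg.gi_symm, ev_gi]
  rw [codiff, neg_eq_zero]
  simp only [hc]
  have : ∀ a m, ginv g y a m * (1 / 24 * ev y (h.alg.c2 h.alg.psi24 m a b))
      = 1 / 24 * (ginv g y m a * ev y (h.alg.c2 h.alg.psi24 m a b)) := fun a m => by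
    rw [hs a m]; ring
  simp only [this, ← Finset.mul_sum, key, mul_zero]

omit h in
theorem pd_complex (p q : SmoothFn U) (y : U) (a : Fin 4) {F : E4 → ℂ}
    (hF : ∀ z : U, F z = (1 / 2) * ((ev z p : ℝ) + Complex.I * ((ev z q : ℝ) : ℂ))) :
    pd a F y = (1 / 2) * ((ev y (SmoothFn.D a p) : ℝ)
      + Complex.I * ((ev y (SmoothFn.D a q) : ℝ) : ℂ)) := by
  have e : F =ᶠ[nhds (y : E4)] fun z =>
      (1 / 2) * (((ext p z : ℝ) : ℂ) + Complex.I * ((ext q z : ℝ) : ℂ)) := by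
    filter_upwards [U.isOpen.mem_nhds y.2] with z hz
    rw [hF ⟨z, hz⟩, ← ext_apply, ← ext_apply]
  have hp := Complex.ofRealCLM.hasFDerivAt.comp (y : E4) (differentiableAt_ext p y).hasFDerivAt
  have hq := Complex.ofRealCLM.hasFDerivAt.comp (y : E4) (differentiableAt_ext q y).hasFDerivAt
  have hd := (hp.add (hq.const_mul Complex.I)).const_mul (1 / 2 : ℂ)
  have e' : fderiv ℝ F y = _ := (hd.congr_of_eventuallyEq e).fderiv
  rw [pd, e', ev_D, ev_D]
  simp [pd, mul_add]

theorem ev_jj_jj (y : U) (T : Fin 4 → Fin 4 → SmoothFn U) (a b : Fin 4) :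
    ev y (h.alg.jj (fun c => h.alg.jj (fun d => T c d) b) a)
      = ∑ c, ∑ d, J y c a * J y d b * ev y (T c d) := by
  simp only [KahlerAlg.jj, map_sum, map_mul, ev_J, Finset.mul_sum, mul_assoc]

/-- As d(ds) = 0, only (i/2) d(ds ∘ J) = -i Hess s(J·,·) survives. It is J-invariant by extremality,
so taking the (1,1)-part changes nothing. -/
theorem ddbar_eq (hE : h.alg.IsExtremal) (y : U) (a b : Fin 4) :
    ddbar J (scal g) y a b =
      -Complex.I * ((ev y (h.alg.jj (fun c => h.alg.hess c b) a) : ℝ) : ℂ) := by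
  have hd : ∀ (z : U) b, dbar J (scal g) z b = (1 / 2) * ((ev z (h.alg.ds b) : ℝ)
      + Complex.I * ((ev z (h.alg.jj h.alg.ds b) : ℝ) : ℂ)) := by
    intro z b
    have e : ∀ c, pd c (scal g) z = ev z (h.alg.ds c) := fun c => h.pd_alg h.scal_eq c z
    simp only [dbar, e, KahlerAlg.jj, map_sum, map_mul, ev_J]
  have hx : ∀ a b, extdOne (dbar J (scal g)) y a b =
      -Complex.I * ((ev y (h.alg.jj (fun c => h.alg.hess c b) a) : ℝ) : ℂ) := by
    intro a b
    rw [extdOne, pd_complex _ _ y a (fun z => hd z b), pd_complex _ _ y b (fun z => hd z a)]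
    have e1 : SmoothFn.D a (h.alg.ds b) = SmoothFn.D b (h.alg.ds a) := h.alg.D_comm a b _
    have e2 := congrArg (ev y) (h.alg.D_jj_ds hE a b)
    have e3 : ev y (2 : SmoothFn U) = 2 := map_ofNat _ 2
    rw [map_sub, map_mul, map_neg, e3, alg_D] at e2
    have e4 : ((ev y (SmoothFn.D a (h.alg.jj h.alg.ds b)) : ℝ) : ℂ)
        - ((ev y (SmoothFn.D b (h.alg.jj h.alg.ds a)) : ℝ) : ℂ)
        = -2 * ((ev y (h.alg.jj (fun c => h.alg.hess c b) a) : ℝ) : ℂ) := by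
      exact_mod_cast congrArg (fun x : ℝ => (x : ℂ)) e2
    rw [e1]
    linear_combination (Complex.I / 2) * e4
  have inv : ∑ c, ∑ d, (J y c a : ℂ) * (J y d b : ℂ) *
      (-Complex.I * ((ev y (h.alg.jj (fun e => h.alg.hess e d) c) : ℝ) : ℂ))
      = -Complex.I * ((ev y (h.alg.jj (fun c => h.alg.hess c b) a) : ℝ) : ℂ) := by
    have e : h.alg.jj (fun c => h.alg.jj (fun d => h.alg.jj (fun e => h.alg.hess e d) c) b) a
        = h.alg.jj (fun c => h.alg.hess c b) a := by
      congr 1; funext c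
      rw [← h.alg.jj_comm]
      exact h.alg.hess_jj_jj hE c b
    have e' := h.ev_jj_jj y (fun c d => h.alg.jj (fun e => h.alg.hess e d) c) a b
    rw [e] at e'
    rw [e']
    push_cast
    simp only [Finset.mul_sum]
    exact Finset.sum_congr rfl fun c _ => Finset.sum_congr rfl fun d _ => by ring
  rw [ddbar, part11]
  simp only [hx, inv]
  ring

/-- By `ddbar_eq` the bracket is the real form `scalRho`, whose contraction is Λ = (s² + 2 Δs)/2
with Δs the trace of Hess s. Removing (Λ/2) ω and dividing by 6 gives 1/24 of the expression in
`psi24_eq`. -/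
theorem psi_formula (hE : h.alg.IsExtremal) (y : U) (a b : Fin 4) :
    (appL J (bach g) y a b : ℂ) = (1 / 6) * primPart g J
      (fun z c d => (scal g z : ℂ) * (ricciForm g J z c d : ℂ)
        + 2 * Complex.I * ddbar J (scal g) z c d) y a b := by
  have hr : ∀ a b, ricciForm g J y a b = ev y (h.alg.rho a b) := by
    intro a b
    simp only [ricciForm, appL, h.ricci_eq, KahlerAlg.rho, KahlerAlg.jj, map_sum, map_mul, ev_J]
  have e2 : ev y (2 : SmoothFn U) = 2 := map_ofNat _ 2
  have e4 : ev y (4 : SmoothFn U) = 4 := map_ofNat _ 4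
  have hb : ∀ c d, (scal g y : ℂ) * (ricciForm g J y c d : ℂ)
        + 2 * Complex.I * ddbar J (scal g) y c d = ((ev y (h.alg.scalRho c d) : ℝ) : ℂ) := by
    intro c d
    rw [h.ddbar_eq hE, hr, h.scal_eq, KahlerAlg.scalRho, map_add, map_mul, map_mul, e2]
    push_cast
    linear_combination (-2 * ((ev y (h.alg.jj (fun e => h.alg.hess e d) c) : ℝ) : ℂ))
      * Complex.I_mul_I
  have hc : contr g J (fun z c d => (scal g z : ℂ) * (ricciForm g J z c d : ℂ)
        + 2 * Complex.I * ddbar J (scal g) z c d) y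
      = ((1 / 2 * ev y (h.alg.sc ^ 2 + 2 * h.alg.lap) : ℝ) : ℂ) := by
    have key := congrArg (ev y) h.alg.sum_bivec_scalRho
    have hk : ∀ a b, raise g (kform g J) y a b = -ev y (h.alg.bivec a b) := by
      intro a b
      rw [h.raise_eq 1 y (fun a b => by rw [h.kform_eq, one_mul]), h.alg.raise_om, map_neg, one_mul]
    rw [contr]
    simp only [hb, hk]
    rw [map_neg] at key
    rw [← neg_neg (ev y (h.alg.sc ^ 2 + 2 * h.alg.lap)), ← key]
    simp only [map_sum, map_mul]
    push_cast
    simp only [neg_mul, Finset.sum_neg_distrib]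
  rw [primPart]
  simp only [hb, hc]
  rw [h.psi_eq hE, h.kform_eq, KahlerAlg.psi24_eq, map_sub, map_mul, map_mul, e4]
  push_cast
  ring

end IsKahler

/-- The Bach tensor of an extremal Kähler metric in coordinates. -/
theorem bach_extremal {U : Opens E4} {g J : MatField} (h : IsKahler U g J)
    (hE : ∀ y ∈ U, ∀ a b, lieEnd (grad g (scal g)) J y a b = 0) :
    (∀ y ∈ U, ∀ a b, bach g y a b = appR J (appL J (bach g)) y a b) ∧
    IsTwoForm U (appL J (bach g)) ∧
    IsType11 U J (appL J (bach g)) ∧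
    IsHarmonic U g (appL J (bach g)) ∧
    IsASD U g J (appL J (bach g)) ∧
    ∀ y ∈ U, ∀ a b,
      (appL J (bach g) y a b : ℂ) = (1 / 6) * primPart g J
        (fun z c d => (scal g z : ℂ) * (ricciForm g J z c d : ℂ)
          + 2 * Complex.I * ddbar J (scal g) z c d) y a b := by
  have hX := h.isExtremal hE
  have hR : ∀ y ∈ U, ∀ a b, bach g y a b = appR J (appL J (bach g)) y a b := by
    intro y hy a b
    have key : h.alg.jj (h.alg.psi24 a) b = h.alg.bach24 a b := by
      have e : h.alg.psi24 a = fun d => -h.alg.jj (h.alg.bach24 a) d := by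
        funext d; exact h.alg.bach24_jj hX a d
      rw [e, KahlerAlg.jj_neg, h.alg.jj_jj, neg_neg]
    rw [h.bach_eq hX ⟨y, hy⟩, ← key, appR]
    simp only [h.psi_eq hX ⟨y, hy⟩, KahlerAlg.jj, map_sum, map_mul, h.ev_J, Finset.mul_sum]
    exact Finset.sum_congr rfl fun c _ => by ring
  refine ⟨hR, ⟨fun a b => ?_, fun y hy a b => ?_⟩, fun y hy a b => ?_,
    ⟨fun y hy => h.extd_psi hX ⟨y, hy⟩, fun y hy => h.codiff_psi hX ⟨y, hy⟩⟩,
    fun y hy => h.hodge_psi hX ⟨y, hy⟩, fun y hy => h.psi_formula hX ⟨y, hy⟩⟩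
  · exact SmoothFn.contDiffOn_of_eq (a := (1 / 24 : ℝ) • h.alg.psi24 a b) fun z => by
      rw [h.psi_eq hX, map_smul, smul_eq_mul]
  · rw [h.psi_eq hX ⟨y, hy⟩, h.psi_eq hX ⟨y, hy⟩, h.alg.psi24_antisymm hX, map_neg, mul_neg]
  -- Since B = ψ(·, J·), the form ψ(J·, J·) is B(J·, ·), that is ψ.
  · have e : appL J (appR J (appL J (bach g))) y a b = appL J (bach g) y a b := by
      simp only [appL]
      exact Finset.sum_congr rfl fun c _ => by rw [hR y hy c b]
    exact e

end Coord

/-! ### Charts of the manifold: from a Kähler surface to its components. -/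

open Bundle

theorem apply_sum_smul_sum_smul {V : Type*} [AddCommGroup V] [Module ℝ V] [TopologicalSpace V]
    (B : V →L[ℝ] V →L[ℝ] ℝ) (x : Fin 4 → V) (v w : Fin 4 → ℝ) :
    B (∑ i, v i • x i) (∑ j, w j • x j) = ∑ i, ∑ j, v i * w j * B (x i) (x j) := by
  simp only [map_sum, map_smul, _root_.sum_apply, _root_.smul_apply, smul_eq_mul,
    Finset.mul_sum]
  rw [Finset.sum_comm]
  exact Finset.sum_congr rfl fun i _ => Finset.sum_congr rfl fun j _ => by ring

theorem apply_apply_eq_sum_mul_smul {V : Type*} [AddCommGroup V] [Module ℝ V] [TopologicalSpace V]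
    {L : V →L[ℝ] V} {x : Fin 4 → V} {A : Matrix (Fin 4) (Fin 4) ℝ}
    (h : ∀ b, L (x b) = ∑ a, A a b • x a) (b : Fin 4) :
    L (L (x b)) = ∑ a, (A * A) a b • x a := by
  simp only [h, map_sum, map_smul, Finset.smul_sum, smul_smul, Matrix.mul_apply, Finset.sum_smul]
  rw [Finset.sum_comm]
  exact Finset.sum_congr rfl fun i _ => Finset.sum_congr rfl fun j _ => by rw [mul_comm]

section Charts

variable {M : Type*} [TopologicalSpace M] [ChartedSpace E4 M] {e : OpenPartialHomeomorph M E4}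

theorem mdifferentiable_of_mem_maximalAtlas (he : e ∈ IsManifold.maximalAtlas (𝓡 4) ∞ M) :
    e.MDifferentiable (𝓡 4) (𝓡 4) :=
  ⟨(contMDiffOn_of_mem_maximalAtlas he).mdifferentiableOn (by simp),
    (contMDiffOn_symm_of_mem_maximalAtlas he).mdifferentiableOn (by simp)⟩

/-- A tangent vector is the combination of the coordinate vectors whose coefficients are its
coordinates. -/
theorem sum_smul_coordVec (y : E4) (v : E4) :
    ∑ a, v a • coordVec e y a = mfderiv (𝓡 4) (𝓡 4) e.symm y v := by
  have hv : v = ∑ a, v a • (EuclideanSpace.single a (1 : ℝ) : E4) := by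
    ext i
    simp [Finset.sum_apply, Pi.single_apply]
  conv_rhs => rw [hv]
  exact ((map_sum (mfderiv (𝓡 4) (𝓡 4) e.symm y) _ _).trans
    (Finset.sum_congr rfl fun a _ => map_smul _ _ _)).symm

theorem mfderiv_mfderiv_symm (he : e ∈ IsManifold.maximalAtlas (𝓡 4) ∞ M) {y : E4}
    (hy : y ∈ e.target) (v : E4) :
    (mfderiv (𝓡 4) (𝓡 4) e (e.symm y) (mfderiv (𝓡 4) (𝓡 4) e.symm y v) : E4) = v :=
  congrArg (fun L => L v) ((mdifferentiable_of_mem_maximalAtlas he).comp_symm_deriv hy)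

theorem mfderiv_symm_mfderiv (he : e ∈ IsManifold.maximalAtlas (𝓡 4) ∞ M) {y : E4}
    (hy : y ∈ e.target) (w : TangentSpace (𝓡 4) (e.symm y)) :
    mfderiv (𝓡 4) (𝓡 4) e.symm y (mfderiv (𝓡 4) (𝓡 4) e (e.symm y) w : E4) = w := by
  have h := (mdifferentiable_of_mem_maximalAtlas he).symm_comp_deriv (e.map_target hy)
  rw [e.right_inv hy] at h
  exact congrArg (fun L => L w) h

/-- The coordinate expression of a linear endomorphism. -/
theorem endIn_spec {J : ∀ x : M, TangentSpace (𝓡 4) x →L[ℝ] TangentSpace (𝓡 4) x}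
    (he : e ∈ IsManifold.maximalAtlas (𝓡 4) ∞ M) {y : E4} (hy : y ∈ e.target) (b : Fin 4) :
    J (e.symm y) (coordVec e y b) = ∑ a, endIn J e y a b • coordVec e y a :=
  ((sum_smul_coordVec y _).trans (mfderiv_symm_mfderiv he hy _)).symm

theorem sum_smul_coordVec_eq_zero (he : e ∈ IsManifold.maximalAtlas (𝓡 4) ∞ M) {y : E4}
    (hy : y ∈ e.target) {v : Fin 4 → ℝ} (hv : ∑ a, v a • coordVec e y a = 0) : v = 0 := by
  have h1 := (sum_smul_coordVec (e := e) y (WithLp.toLp 2 v)).symm.trans hv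
  have h2 := mfderiv_mfderiv_symm he hy (WithLp.toLp 2 v)
  rw [h1] at h2
  have h3 : (WithLp.toLp 2 v : E4) = 0 :=
    h2.symm.trans (map_zero (mfderiv (𝓡 4) (𝓡 4) e (e.symm y)))
  funext a
  exact congrArg (fun w : E4 => w a) h3

variable [IsManifold (𝓡 4) ∞ M]

theorem contMDiffOn_coordVec (he : e ∈ IsManifold.maximalAtlas (𝓡 4) ∞ M) (i : Fin 4) :
    ContMDiffOn 𝓘(ℝ, E4) ((𝓡 4).prod 𝓘(ℝ, E4)) ∞
      (fun y => TotalSpace.mk' E4 (E := fun x : M => TangentSpace (𝓡 4) x)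
        (e.symm y) (coordVec e y i)) e.target := by
  have h1 := (contMDiffOn_symm_of_mem_maximalAtlas he).contMDiffOn_tangentMapWithin (m := ∞)
    (by simp) e.open_target.uniqueMDiffOn
  have h2 : ContMDiffOn 𝓘(ℝ, E4) (𝓡 4).tangent ∞
      (fun y : E4 => (⟨y, (EuclideanSpace.single i (1 : ℝ) : E4)⟩ : TangentBundle (𝓡 4) E4))
      e.target :=
    contMDiffOn_vectorSpace_iff_contDiffOn.mpr contDiffOn_const
  refine (h1.comp h2 fun y hy => hy).congr fun y hy => ?_
  simp only [Function.comp, tangentMapWithin]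
  rw [mfderivWithin_of_isOpen e.open_target hy]
  rfl

theorem contDiffOn_metricIn
    (g : Bundle.ContMDiffRiemannianMetric (𝓡 4) ∞ E4 (fun x : M => TangentSpace (𝓡 4) x))
    (he : e ∈ IsManifold.maximalAtlas (𝓡 4) ∞ M) (i j : Fin 4) :
    ContDiffOn ℝ ∞ (fun y => metricIn g e y i j) e.target := by
  have hs := contMDiffOn_symm_of_mem_maximalAtlas he
  have hg : ContMDiffOn 𝓘(ℝ, E4) ((𝓡 4).prod 𝓘(ℝ, E4 →L[ℝ] E4 →L[ℝ] ℝ)) ∞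
      (fun y => TotalSpace.mk' (E4 →L[ℝ] E4 →L[ℝ] ℝ)
        (E := fun x : M => TangentSpace (𝓡 4) x →L[ℝ] TangentSpace (𝓡 4) x →L[ℝ] ℝ)
        (e.symm y) (g.inner (e.symm y))) e.target :=
    g.contMDiff.comp_contMDiffOn hs
  have h := ContMDiffOn.clm_bundle_apply₂ (F₁ := E4) (F₂ := E4) (F₃ := ℝ)
    (E₁ := fun x : M => TangentSpace (𝓡 4) x) (E₂ := fun x : M => TangentSpace (𝓡 4) x)
    (E₃ := fun _ : M => ℝ) hg (contMDiffOn_coordVec he i) (contMDiffOn_coordVec he j)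
  rw [← contMDiffOn_iff_contDiffOn]
  intro y hy
  have := (contMDiffWithinAt_totalSpace.mp (h y hy)).2
  exact this

/-- J applied to a smooth coordinate vector field is a smooth section along the inverse chart; the
tangent map of the chart carries it to the model space, where a component of its fibre part is read
off. -/
theorem contDiffOn_endIn {J : ∀ x : M, TangentSpace (𝓡 4) x →L[ℝ] TangentSpace (𝓡 4) x}
    (hJ : ContMDiff (𝓡 4) ((𝓡 4).prod 𝓘(ℝ, E4 →L[ℝ] E4)) ∞
      (fun x => Bundle.TotalSpace.mk' (E4 →L[ℝ] E4)
        (E := fun x : M => TangentSpace (𝓡 4) x →L[ℝ] TangentSpace (𝓡 4) x) x (J x)))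
    (he : e ∈ IsManifold.maximalAtlas (𝓡 4) ∞ M) (a b : Fin 4) :
    ContDiffOn ℝ ∞ (fun y => endIn J e y a b) e.target := by
  have hs := contMDiffOn_symm_of_mem_maximalAtlas he
  have hJ' : ContMDiffOn 𝓘(ℝ, E4) ((𝓡 4).prod 𝓘(ℝ, E4 →L[ℝ] E4)) ∞
      (fun y => TotalSpace.mk' (E4 →L[ℝ] E4)
        (E := fun x : M => TangentSpace (𝓡 4) x →L[ℝ] TangentSpace (𝓡 4) x)
        (e.symm y) (J (e.symm y))) e.target :=
    hJ.comp_contMDiffOn hs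
  have h := ContMDiffOn.clm_bundle_apply (F₁ := E4) (F₂ := E4)
    (E₁ := fun x : M => TangentSpace (𝓡 4) x) (E₂ := fun x : M => TangentSpace (𝓡 4) x)
    hJ' (contMDiffOn_coordVec he b)
  have h1 := (contMDiffOn_of_mem_maximalAtlas he).contMDiffOn_tangentMapWithin (m := ∞)
    (by simp) e.open_source.uniqueMDiffOn
  have h2 := h1.comp h fun y hy => e.map_target hy
  have h3 := (contMDiff_snd_tangentBundle_modelSpace E4 (𝓡 4) (n := ∞)).comp_contMDiffOn h2
  let f : E4 → E4 := fun y =>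
    mfderiv (𝓡 4) (𝓡 4) e (e.symm y) (J (e.symm y) (coordVec e y b))
  have h4 : ContMDiffOn 𝓘(ℝ, E4) 𝓘(ℝ, E4) ∞ f e.target := by
    refine h3.congr fun y hy => ?_
    simp only [Function.comp, tangentMapWithin]
    rw [mfderivWithin_of_isOpen e.open_source (e.map_target hy)]
  exact contDiffOn_euclidean.mp (contMDiffOn_iff_contDiffOn.mp h4) a

theorem metricIn_sum
    (g : Bundle.ContMDiffRiemannianMetric (𝓡 4) ∞ E4 (fun x : M => TangentSpace (𝓡 4) x))
    (y : E4) (v w : Fin 4 → ℝ) :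
    g.inner (e.symm y) (∑ i, v i • coordVec e y i) (∑ j, w j • coordVec e y j)
      = ∑ i, ∑ j, v i * w j * metricIn g e y i j := by
  simpa only [metricIn, Matrix.of_apply] using! apply_sum_smul_sum_smul (g.inner (e.symm y)) _ v w

/-- In a chart, a Kähler surface is a Kähler structure on an open set of the model space. -/
theorem KahlerSurface.isKahler (K : KahlerSurface M)
    (he : e ∈ IsManifold.maximalAtlas (𝓡 4) ∞ M) :
    Coord.IsKahler ⟨e.target, e.open_target⟩ (metricIn K.g e) (endIn K.J e) where
  smooth_g := contDiffOn_metricIn K.g he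
  smooth_J := contDiffOn_endIn K.contMDiff_J he
  g_symm y _ a b := K.g.symm _ _ _
  det_pos y hy := by
    -- The component matrix is the Gram matrix of the coordinate vectors, which are linearly
    -- independent, so it is positive definite.
    refine Matrix.PosDef.det_pos (Matrix.PosDef.of_dotProduct_mulVec_pos ?_ fun v hv => ?_)
    · ext a b
      exact K.g.symm _ _ _
    · have h := K.g.pos (e.symm y) (∑ i, v i • coordVec e y i)
        fun h0 => hv (sum_smul_coordVec_eq_zero he hy h0)
      rw [metricIn_sum] at h
      refine lt_of_lt_of_eq h ?_
      simp only [dotProduct, Matrix.mulVec, Finset.mul_sum, Pi.star_apply, star_trivial]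
      exact Finset.sum_congr rfl fun i _ => Finset.sum_congr rfl fun j _ => by ring
  J_sq y hy := by
    ext a b
    have h := (apply_apply_eq_sum_mul_smul (endIn_spec (J := K.J) he hy) b).symm.trans
      (K.J_sq (e.symm y) (coordVec e y b))
    have h0 : ∑ i, (endIn K.J e y * endIn K.J e y + 1) i b • coordVec e y i = 0 := by
      simp only [Matrix.add_apply, Matrix.one_apply, add_smul, Finset.sum_add_distrib, ite_smul,
        one_smul, zero_smul, Finset.sum_ite_eq', Finset.mem_univ, if_true]
      rw [h, neg_add_cancel]
    exact eq_neg_of_add_eq_zero_left (congrFun (sum_smul_coordVec_eq_zero he hy h0) a)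
  J_g y hy := by
    ext a b
    have h := K.hermitian (e.symm y) (coordVec e y a) (coordVec e y b)
    rw [endIn_spec he hy a, endIn_spec he hy b, metricIn_sum] at h
    refine Eq.trans ?_ h
    simp only [Matrix.mul_apply, Matrix.transpose_apply, Finset.sum_mul]
    rw [Finset.sum_comm]
    exact Finset.sum_congr rfl fun i _ => Finset.sum_congr rfl fun j _ => by ring
  closed := K.closed e he
  nij := K.integrable e he

end Charts

end

/-- The components, in an arbitrary chart `e` of the smooth atlas, of the Bach tensor `B` and of
`ψ = B(J·, ·)`. -/
theorem mainTheorem11 {M : Type*} [TopologicalSpace M] [ChartedSpace E4 M]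
    [IsManifold (𝓡 4) ∞ M] (K : KahlerSurface M) (hK : K.IsExtremal)
    (e : OpenPartialHomeomorph M E4) (he : e ∈ IsManifold.maximalAtlas (𝓡 4) ∞ M) :
    let g := metricIn K.g e
    let J := endIn K.J e
    let B := Coord.bach g
    let ψ := Coord.appL J B
    (∀ y ∈ e.target, ∀ a b, B y a b = Coord.appR J ψ y a b) ∧
    Coord.IsTwoForm e.target ψ ∧
    Coord.IsType11 e.target J ψ ∧
    Coord.IsHarmonic e.target g ψ ∧
    Coord.IsASD e.target g J ψ ∧
    ∀ y ∈ e.target, ∀ a b,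
      (ψ y a b : ℂ) = (1 / 6) * Coord.primPart g J
        (fun z c d => (Coord.scal g z : ℂ) * (Coord.ricciForm g J z c d : ℂ)
          + 2 * Complex.I * Coord.ddbar J (Coord.scal g) z c d) y a b := by
  exact Coord.bach_extremal (K.isKahler he) (hK e he)
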